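/- Let $0<\sigma<1$ and $3<\alpha\le 4$. For $0\le t,s\le 1$ put $$G(t,s)=\frac{1}{\Gamma(\alpha)}\begin{cases}(t-s)^{\alpha-1}+(1-s)^{\alpha-2}t^{\alpha-2}\left[(s-t)+(\alpha-2)(1-t)s\right], & 0\le s\le t\le 1,\\ (1-s)^{\alpha-2}t^{\alpha-2}\left[(s-t)+(\alpha-2)(1-t)s\right], & 0\le t< s\le 1.\end{cases}$$ Then the maximum $N=\max_{0\le t\le 1}\int_0^1 G(t,s)\,s^{-\sigma}\,ds$ exists and is positive, and the following holds. Let $f:(0,1]\times[0,\infty)\to[0,\infty)$ be continuous with $\lim_{t\to0^+}f(t,y)=\infty$ for every $y\ge 0$, and suppose that $(t,y)\mapsto t^\sigma f(t,y)$ extends to a continuous function on $[0,1]\times[0,\infty)$. Suppose that there are constants $0<\lambda\le 1/N$ and $\tau>0$ such that for all $x,y\in[0,\infty)$ and $t\in(0,1]$ $$t^\sigma|f(t,x)-f(t,y)|\le\frac{\lambda|x-y|}{\left(1+\tau\sqrt{|x-y|}\right)^2}.$$ Then the boundary value problem $$D_{0+}^\alpha u(t)=f(t,u(t))\quad(0<t<1),\qquad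 u(0)=u(1)=u'(0)=u'(1)=0,$$ has a unique non-negative solution $u\in C[0,1]$. Here $D_{0+}^\alpha u(t)=\frac{1}{\Gamma(n-\alpha)}\left(\frac{d}{dt}\right)^n\int_0^t(t-s)^{n-\alpha-1}u(s)\,ds$ with $n=\lfloor\alpha\rfloor+1$ is the Riemann–Liouville derivative, which a solution is required to possess at every $t\in(0,1)$, and the derivatives at the end points are one-sided. -/

import Mathlib

open Set Filter Topology

noncomputable section

/-- The Riemann–Liouville fractional integral of order `β > 0` with base point `0`:
`(1 / Γ(β)) ∫₀ᵗ (t - s)^(β - 1) u(s) ds`. -/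
def rlIntegral (β : ℝ) (u : ℝ → ℝ) (t : ℝ) : ℝ :=
  (1 / Real.Gamma β) * ∫ s in (0 : ℝ)..t, (t - s) ^ (β - 1) * u s

/-- The number `n = ⌊α⌋ + 1` of classical derivatives in the Riemann–Liouville derivative of
order `α`; then `n - α > 0`, also for integer `α`. -/
def rlOrder (α : ℝ) : ℕ := ⌊α⌋₊ + 1

/-- The Riemann–Liouville fractional derivative of order `α` with base point `0`:
`(d/dt)ⁿ` of the fractional integral of order `n - α`, where `n = ⌊α⌋ + 1`. -/
def rlDeriv (α : ℝ) (u : ℝ → ℝ) (t : ℝ) : ℝ :=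
  iteratedDeriv (rlOrder α) (rlIntegral ((rlOrder α : ℝ) - α) u) t

/-- The Riemann–Liouville derivative of order `α` of `u` exists at every point of the open
set `s`: the fractional integral of order `n - α` is `n` times differentiable there. -/
def RLDifferentiableOn (α : ℝ) (u : ℝ → ℝ) (s : Set ℝ) : Prop :=
  ∀ k < rlOrder α, ∀ t ∈ s,
    DifferentiableAt ℝ (iteratedDeriv k (rlIntegral ((rlOrder α : ℝ) - α) u)) t

/-- The Green function `G(t, s)` of the problem
`D^α u = h`, `u(0) = u(1) = u'(0) = u'(1) = 0`, for `t, s ∈ [0, 1]`. -/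
def green (α t s : ℝ) : ℝ :=
  if s ≤ t then
    ((t - s) ^ (α - 1) +
      (1 - s) ^ (α - 2) * t ^ (α - 2) * ((s - t) + (α - 2) * (1 - t) * s)) / Real.Gamma α
  else
    ((1 - s) ^ (α - 2) * t ^ (α - 2) * ((s - t) + (α - 2) * (1 - t) * s)) / Real.Gamma α

/-- `u` (only its values on `[0, 1]` matter) is a non-negative solution in `C[0, 1]` of
`D^α u(t) = f(t, u(t))` for `0 < t < 1`, `u(0) = u(1) = u'(0) = u'(1) = 0`.
The derivatives at the end points are the one-sided ones. -/
structure IsNonnegSolution (α : ℝ) (f : ℝ → ℝ → ℝ) (u : ℝ → ℝ) : Prop where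
  continuousOn : ContinuousOn u (Icc 0 1)
  nonneg : ∀ t ∈ Icc (0 : ℝ) 1, 0 ≤ u t
  differentiable : RLDifferentiableOn α u (Ioo 0 1)
  equation : ∀ t ∈ Ioo (0 : ℝ) 1, rlDeriv α u t = f t (u t)
  left_value : u 0 = 0
  right_value : u 1 = 0
  left_deriv : HasDerivWithinAt u 0 (Icc 0 1) 0
  right_deriv : HasDerivWithinAt u 0 (Icc 0 1) 1

end

noncomputable section

open MeasureTheory intervalIntegral

/-! The problem is equivalent to the fixed point equation `u(t) = ∫ G(t,s) f(s,u(s)) ds` on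
non-negative continuous functions. The source `f(s,u(s))` is `s^(-σ)` times a continuous function,
hence integrable up to the origin and continuous away from it; the linear theory is developed for
such `h` (`RLAdmissible`).

Linear problem `D^α v = h`. The integral `I^(n-α) v` differs from the `n`-fold primitive of `h` by a
polynomial of degree below `n`. Applying `I^(2-(n-α))` and using the semigroup law
`rlIntegral_rlIntegral` gives a formula for `I^2 v`; two differentiations yield `v = I^α h + ∑ d_k
t^(k-(n-α))` (`eq_rlIntegral_add_sum_rpow`). Continuity and the data at `0` leave only `t^(α-1)` and
`t^(α-2)`, and the data at `1` fix their coefficients; the result is the Green integral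
(`IsClampedSolution.eqOn_greenOp`). Conversely the Green integral solves the problem
(`isClampedSolution_greenOp`).

Nonlinear problem. `G ≥ 0` by Bernoulli's inequality (`green_nonneg`), so the operator preserves
non-negativity. As `λN ≤ 1`, it moves two functions at distance `d` to distance at most `φ(d) =
d/(1+τ√d)^2`. Since `1/√φ(d) = 1/√d + τ`, successive Picard distances are at most `1/(nτ)^2`, which
is summable: the iterates converge. Uniqueness holds because `φ(d) < d` for `d > 0`. -/

/-! ### Beta integrals and the semigroup law. -/

theorem integral_rpow_mul_sub_rpow {a b x : ℝ} (ha : 0 < a) (hb : 0 < b) (hx : 0 < x) :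
    ∫ r in (0 : ℝ)..x, r ^ (a - 1) * (x - r) ^ (b - 1)
      = x ^ (a + b - 1) * (Real.Gamma a * Real.Gamma b / Real.Gamma (a + b)) := by
  have h := Complex.betaIntegral_scaled a b hx
  have hB : Complex.betaIntegral a b
      = ((Real.Gamma a * Real.Gamma b / Real.Gamma (a + b) : ℝ) : ℂ) := by
    rw [Complex.betaIntegral_eq_Gamma_mul_div _ _ (by simpa) (by simpa)]
    rw [← Complex.ofReal_add]
    rw [Complex.Gamma_ofReal, Complex.Gamma_ofReal, Complex.Gamma_ofReal, Complex.ofReal_div,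
      Complex.ofReal_mul]
  have hL : ∫ r in (0 : ℝ)..x, (r : ℂ) ^ ((a : ℂ) - 1) * ((x : ℂ) - r) ^ ((b : ℂ) - 1)
      = ((∫ r in (0 : ℝ)..x, r ^ (a - 1) * (x - r) ^ (b - 1) : ℝ) : ℂ) := by
    rw [← intervalIntegral.integral_ofReal]
    refine intervalIntegral.integral_congr fun r hr => ?_
    rw [uIcc_of_le hx.le] at hr
    rw [Complex.ofReal_mul, Complex.ofReal_cpow hr.1, Complex.ofReal_cpow (sub_nonneg.2 hr.2)]
    push_cast
    rfl
  rw [hL, hB] at h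
  have hx' : (x : ℂ) ^ ((a : ℂ) + b - 1) = ((x ^ (a + b - 1) : ℝ) : ℂ) := by
    rw [Complex.ofReal_cpow hx.le]; push_cast; rfl
  rw [hx'] at h
  exact_mod_cast h

theorem integral_sub_rpow_mul_sub_rpow {a b s t : ℝ} (ha : 0 < a) (hb : 0 < b) (hst : s < t) :
    ∫ r in s..t, (t - r) ^ (a - 1) * (r - s) ^ (b - 1)
      = (t - s) ^ (a + b - 1) * (Real.Gamma a * Real.Gamma b / Real.Gamma (a + b)) := by
  have h := integral_rpow_mul_sub_rpow hb ha (sub_pos.2 hst)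
  have h2 := intervalIntegral.integral_comp_sub_right (a := s) (b := t)
    (fun r => r ^ (b - 1) * (t - s - r) ^ (a - 1)) s
  rw [sub_self] at h2
  rw [h] at h2
  rw [add_comm a b, mul_comm (Real.Gamma a), ← h2]
  refine intervalIntegral.integral_congr fun r _ => ?_
  simp only [sub_sub_sub_cancel_right]
  ring

/-- A non-integrable function has integral `0` by convention, whereas the Beta value just computed
is positive. -/
theorem intervalIntegrable_sub_rpow_mul_sub_rpow {a b s t : ℝ} (ha : 0 < a) (hb : 0 < b)
    (hst : s < t) :
    IntervalIntegrable (fun r => (t - r) ^ (a - 1) * (r - s) ^ (b - 1)) volume s t := by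
  by_contra hc
  have h := integral_sub_rpow_mul_sub_rpow ha hb hst
  rw [intervalIntegral.integral_undef hc] at h
  have h1 := Real.rpow_pos_of_pos (sub_pos.2 hst) (a + b - 1)
  have h2 := Real.Gamma_pos_of_pos ha
  have h3 := Real.Gamma_pos_of_pos hb
  have h4 := Real.Gamma_pos_of_pos (add_pos ha hb)
  have : 0 < (t - s) ^ (a + b - 1) * (Real.Gamma a * Real.Gamma b / Real.Gamma (a + b)) := by
    positivity
  linarith

/-- The kernel of the iterated fractional integral, cut off to the triangle `s < r`. -/
def rlKernel (a b : ℝ) (h : ℝ → ℝ) (t : ℝ) (p : ℝ × ℝ) : ℝ :=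
  {q : ℝ × ℝ | q.2 < q.1}.indicator
    (fun q => (t - q.1) ^ (a - 1) * (q.1 - q.2) ^ (b - 1) * h q.2) p

theorem rlKernel_slice_left {a b : ℝ} {h : ℝ → ℝ} {t s : ℝ} (hs : s ∈ Ioc 0 t) :
    (Ioc 0 t).indicator (fun r => rlKernel a b h t (r, s))
      = (Ioc s t).indicator (fun r => (t - r) ^ (a - 1) * (r - s) ^ (b - 1) * h s) := by
  funext r
  simp only [rlKernel, indicator, mem_Ioc, mem_ofPred_eq]
  by_cases h1 : s < r <;> by_cases h2 : r ≤ t <;> simp [h1, h2]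
  intro h3
  exact absurd (hs.1.trans h1) (not_lt.2 h3)

theorem rlKernel_slice_right {a b : ℝ} {h : ℝ → ℝ} {t r : ℝ} (hr : r ∈ Ioc 0 t) :
    (Ioc 0 t).indicator (fun s => rlKernel a b h t (r, s))
      = (Ioo 0 r).indicator (fun s => (t - r) ^ (a - 1) * ((r - s) ^ (b - 1) * h s)) := by
  funext s
  simp only [rlKernel, indicator, mem_Ioc, mem_Ioo, mem_ofPred_eq]
  by_cases h1 : s < r <;> by_cases h2 : 0 < s <;> simp [h1, h2, mul_assoc]
  intro h3
  exact absurd (h1.le.trans hr.2) (not_le.2 h3)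

theorem integrableOn_rlKernel_slice {a b : ℝ} (ha : 0 < a) (hb : 0 < b) {h : ℝ → ℝ} {t s : ℝ}
    (hs : s ∈ Ioc 0 t) : IntegrableOn (fun r => rlKernel a b h t (r, s)) (Ioc 0 t) := by
  rw [← integrable_indicator_iff measurableSet_Ioc, rlKernel_slice_left hs,
    integrable_indicator_iff measurableSet_Ioc]
  rcases hs.2.eq_or_lt with e | hlt
  · simp [e]
  · exact ((intervalIntegrable_iff_integrableOn_Ioc_of_le hlt.le).1
      (intervalIntegrable_sub_rpow_mul_sub_rpow ha hb hlt)).mul_const _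

theorem setIntegral_rlKernel_slice {a b : ℝ} (ha : 0 < a) (hb : 0 < b) {h : ℝ → ℝ} {t s : ℝ}
    (hs : s ∈ Ioo 0 t) : ∫ r in Ioc 0 t, rlKernel a b h t (r, s)
      = (Real.Gamma a * Real.Gamma b / Real.Gamma (a + b)) * ((t - s) ^ (a + b - 1) * h s) := by
  rw [← MeasureTheory.integral_indicator measurableSet_Ioc, rlKernel_slice_left ⟨hs.1, hs.2.le⟩,
    MeasureTheory.integral_indicator measurableSet_Ioc, MeasureTheory.integral_mul_const,
    ← intervalIntegral.integral_of_le hs.2.le, integral_sub_rpow_mul_sub_rpow ha hb hs.2]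
  ring

theorem norm_rlKernel {a b : ℝ} {h : ℝ → ℝ} {t r s : ℝ} (hr : r ≤ t) :
    ‖rlKernel a b h t (r, s)‖ = rlKernel a b (fun x => ‖h x‖) t (r, s) := by
  simp only [rlKernel, indicator, mem_ofPred_eq]
  split_ifs with h1
  · rw [norm_mul, norm_mul, Real.norm_of_nonneg (Real.rpow_nonneg (sub_nonneg.2 hr) _),
      Real.norm_of_nonneg (Real.rpow_nonneg (sub_nonneg.2 h1.le) _)]
  · simp

theorem integrableOn_Ioc_sub_rpow_mul {c : ℝ} (hc : 0 ≤ c) {h : ℝ → ℝ} {t : ℝ}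
    (hh : IntegrableOn h (Ioc 0 t)) :
    IntegrableOn (fun s => (t - s) ^ c * h s) (Ioc 0 t) := by
  have hcont : Continuous fun s : ℝ => (t - s) ^ c :=
    (Real.continuous_rpow_const hc).comp (continuous_const.sub continuous_id)
  rcases le_or_gt t 0 with ht | ht
  · simp [Ioc_eq_empty (not_lt.2 ht)]
  rw [← intervalIntegrable_iff_integrableOn_Ioc_of_le ht.le] at hh ⊢
  exact hh.continuousOn_mul hcont.continuousOn

/-- Tonelli: integrating the norm over `r` first gives a constant times `(t-s)^(a+b-1) |h s|`, whose
weight is bounded because `a + b ≥ 1`. -/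
theorem integrable_rlKernel {a b : ℝ} (ha : 0 < a) (hb : 0 < b) (hab : 1 ≤ a + b) {h : ℝ → ℝ}
    {t : ℝ} (hh : IntegrableOn h (Ioc 0 t)) :
    Integrable (rlKernel a b h t)
      ((volume.restrict (Ioc 0 t)).prod (volume.restrict (Ioc 0 t))) := by
  have hmeas : AEStronglyMeasurable (rlKernel a b h t)
      ((volume.restrict (Ioc 0 t)).prod (volume.restrict (Ioc 0 t))) := by
    refine AEStronglyMeasurable.indicator ?_ (measurableSet_lt measurable_snd measurable_fst)
    refine AEStronglyMeasurable.mul ?_ hh.aestronglyMeasurable.comp_snd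
    exact Measurable.aestronglyMeasurable (by fun_prop)
  rw [integrable_prod_iff' hmeas]
  constructor
  · filter_upwards [ae_restrict_mem measurableSet_Ioc] with s hs
    exact integrableOn_rlKernel_slice ha hb hs
  · refine ((integrableOn_Ioc_sub_rpow_mul (by linarith : 0 ≤ a + b - 1) hh.norm).const_mul
      (Real.Gamma a * Real.Gamma b / Real.Gamma (a + b))).congr ?_
    have hne : ∀ᵐ s ∂(volume.restrict (Ioc (0 : ℝ) t)), s ≠ t :=
      ae_restrict_of_ae (Measure.ae_ne volume t)
    filter_upwards [ae_restrict_mem measurableSet_Ioc, hne] with s hs hst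
    refine (setIntegral_rlKernel_slice ha hb (h := fun x => ‖h x‖)
      ⟨hs.1, lt_of_le_of_ne hs.2 hst⟩).symm.trans ?_
    refine setIntegral_congr_fun measurableSet_Ioc fun r hr => ?_
    exact (norm_rlKernel hr.2).symm

theorem setIntegral_rlKernel_slice_right {a b : ℝ} (hb : 0 < b) {h : ℝ → ℝ} {t r : ℝ}
    (hr : r ∈ Ioc 0 t) : ∫ s in Ioc 0 t, rlKernel a b h t (r, s)
      = Real.Gamma b * ((t - r) ^ (a - 1) * rlIntegral b h r) := by
  rw [← MeasureTheory.integral_indicator measurableSet_Ioc, rlKernel_slice_right hr,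
    MeasureTheory.integral_indicator measurableSet_Ioo, ← integral_Ioc_eq_integral_Ioo,
    MeasureTheory.integral_const_mul, ← intervalIntegral.integral_of_le hr.1.le, rlIntegral]
  have := (Real.Gamma_pos_of_pos hb).ne'
  field_simp

/-- The semigroup property of fractional integrals. -/
theorem rlIntegral_rlIntegral {a b : ℝ} (ha : 0 < a) (hb : 0 < b) (hab : 1 ≤ a + b) {h : ℝ → ℝ}
    {t : ℝ} (ht : 0 ≤ t) (hh : IntervalIntegrable h volume 0 t) :
    rlIntegral a (rlIntegral b h) t = rlIntegral (a + b) h t := by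
  rw [intervalIntegrable_iff_integrableOn_Ioc_of_le ht] at hh
  have hi := integrable_rlKernel ha hb hab hh
  have hsw := integral_integral_swap (f := fun r s => rlKernel a b h t (r, s)) hi
  have h1 : ∫ r in Ioc 0 t, ∫ s in Ioc 0 t, rlKernel a b h t (r, s)
      = Real.Gamma b * ∫ r in Ioc 0 t, (t - r) ^ (a - 1) * rlIntegral b h r := by
    rw [← MeasureTheory.integral_const_mul]
    exact setIntegral_congr_fun measurableSet_Ioc fun r hr =>
      setIntegral_rlKernel_slice_right hb hr
  have h2 : ∫ s in Ioc 0 t, ∫ r in Ioc 0 t, rlKernel a b h t (r, s)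
      = (Real.Gamma a * Real.Gamma b / Real.Gamma (a + b))
        * ∫ s in Ioc 0 t, (t - s) ^ (a + b - 1) * h s := by
    rw [← MeasureTheory.integral_const_mul, integral_Ioc_eq_integral_Ioo,
      integral_Ioc_eq_integral_Ioo]
    exact setIntegral_congr_fun measurableSet_Ioo fun s hs =>
      setIntegral_rlKernel_slice ha hb hs
  rw [h1, h2] at hsw
  have g1 := (Real.Gamma_pos_of_pos ha).ne'
  have g2 := (Real.Gamma_pos_of_pos hb).ne'
  have g3 := (Real.Gamma_pos_of_pos (add_pos ha hb)).ne'
  rw [rlIntegral, rlIntegral, intervalIntegral.integral_of_le ht,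
    intervalIntegral.integral_of_le ht]
  field_simp at hsw ⊢
  linear_combination hsw

theorem intervalIntegrable_rlIntegral {b : ℝ} (hb : 0 < b) {h : ℝ → ℝ} {t : ℝ} (ht : 0 ≤ t)
    (hh : IntervalIntegrable h volume 0 t) :
    IntervalIntegrable (rlIntegral b h) volume 0 t := by
  rw [intervalIntegrable_iff_integrableOn_Ioc_of_le ht] at hh ⊢
  -- With outer order `1` the weight `(t-r)^0` is `1`, so Fubini's inner integral is `Γ(b) I^b h`
  -- itself.
  have hi := (integrable_rlKernel one_pos hb (by linarith) hh).integral_prod_left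
  have g := (Real.Gamma_pos_of_pos hb).ne'
  refine (hi.const_mul (Real.Gamma b)⁻¹).congr ?_
  filter_upwards [ae_restrict_mem measurableSet_Ioc] with r hr
  rw [setIntegral_rlKernel_slice_right hb hr]
  simp [g]

theorem rlIntegral_one (h : ℝ → ℝ) (t : ℝ) : rlIntegral 1 h t = ∫ s in (0 : ℝ)..t, h s := by
  simp [rlIntegral]

theorem rlIntegral_zero_right {b : ℝ} (h : ℝ → ℝ) : rlIntegral b h 0 = 0 := by
  simp [rlIntegral]

theorem rlIntegral_congr {b t : ℝ} {h k : ℝ → ℝ} (ht : 0 ≤ t) (hk : EqOn h k (Ioo 0 t)) :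
    rlIntegral b h t = rlIntegral b k t := by
  simp only [rlIntegral]
  rw [intervalIntegral.integral_of_le ht, intervalIntegral.integral_of_le ht,
    integral_Ioc_eq_integral_Ioo, integral_Ioc_eq_integral_Ioo]
  congr 1
  exact setIntegral_congr_fun measurableSet_Ioo fun s hs => by simp only [hk hs]

/-- The fractional integral of a power. -/
theorem rlIntegral_rpow {b c t : ℝ} (hb : 0 < b) (hc : -1 < c) (ht : 0 < t) :
    rlIntegral b (fun s => s ^ c) t
      = Real.Gamma (c + 1) / Real.Gamma (c + 1 + b) * t ^ (c + b) := by
  have h := integral_rpow_mul_sub_rpow (a := c + 1) (by linarith) hb ht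
  have e : ∫ s in (0 : ℝ)..t, (t - s) ^ (b - 1) * s ^ c
      = ∫ s in (0 : ℝ)..t, s ^ (c + 1 - 1) * (t - s) ^ (b - 1) := by
    refine intervalIntegral.integral_congr fun s _ => ?_
    simp only [add_sub_cancel_right, mul_comm]
  have g := (Real.Gamma_pos_of_pos hb).ne'
  rw [rlIntegral, e, h, show c + 1 + b - 1 = c + b by ring]
  field_simp

/-! ### Regularity of fractional integrals. -/

/-- `h` is integrable up to the origin and continuous away from it. -/
structure RLAdmissible (h : ℝ → ℝ) : Prop where
  intervalIntegrable : ∀ t, 0 ≤ t → IntervalIntegrable h volume 0 t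
  continuousAt : ∀ t, 0 < t → ContinuousAt h t

theorem continuousOn_integral_Ici {h : ℝ → ℝ}
    (hh : ∀ t, 0 ≤ t → IntervalIntegrable h volume 0 t) :
    ContinuousOn (fun t => ∫ s in (0 : ℝ)..t, h s) (Ici 0) := by
  intro t ht
  have h1 := intervalIntegral.continuousOn_primitive_interval'
    (hh (t + 1) (by linarith [mem_Ici.1 ht])) left_mem_uIcc
  rw [uIcc_of_le (by linarith [mem_Ici.1 ht])] at h1
  refine (h1 t ⟨ht, by linarith⟩).mono_of_mem_nhdsWithin ?_
  rw [mem_nhdsWithin]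
  exact ⟨Iio (t + 1), isOpen_Iio, by simp, fun x hx => ⟨hx.2, le_of_lt hx.1⟩⟩

theorem rlIntegral_add_one_eq {b : ℝ} (hb : 0 < b) {h : ℝ → ℝ} (hh : RLAdmissible h) {t : ℝ}
    (ht : 0 ≤ t) : rlIntegral (b + 1) h t = ∫ s in (0 : ℝ)..t, rlIntegral b h s := by
  rw [add_comm, ← rlIntegral_rlIntegral one_pos hb (by linarith) ht (hh.intervalIntegrable t ht),
    rlIntegral_one]

theorem continuousOn_rlIntegral {b : ℝ} (hb : 1 ≤ b) {h : ℝ → ℝ} (hh : RLAdmissible h) :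
    ContinuousOn (rlIntegral b h) (Ici 0) := by
  rcases hb.eq_or_lt with rfl | hb
  · exact (continuousOn_integral_Ici hh.intervalIntegrable).congr fun t _ => rlIntegral_one h t
  · refine (continuousOn_integral_Ici fun t ht =>
      intervalIntegrable_rlIntegral (sub_pos.2 hb) ht (hh.intervalIntegrable t ht)).congr
      fun t ht => ?_
    have := rlIntegral_add_one_eq (sub_pos.2 hb) hh ht
    rwa [sub_add_cancel] at this

theorem hasDerivAt_integral_of_continuousAt {h : ℝ → ℝ} {t : ℝ}
    (hi : IntervalIntegrable h volume 0 t) (hc : ∀ᶠ x in 𝓝 t, ContinuousAt h x) :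
    HasDerivAt (fun x => ∫ s in (0 : ℝ)..x, h s) (h t) t := by
  obtain ⟨u, hu, huo, htu⟩ := eventually_nhds_iff.1 hc
  refine intervalIntegral.integral_hasDerivAt_right hi ?_ hc.self_of_nhds
  exact ContinuousAt.stronglyMeasurableAtFilter huo hu t htu

theorem hasDerivAt_rlIntegral_one {h : ℝ → ℝ} (hh : RLAdmissible h) {t : ℝ} (ht : 0 < t) :
    HasDerivAt (rlIntegral 1 h) (h t) t := by
  have := hasDerivAt_integral_of_continuousAt (hh.intervalIntegrable t ht.le)
    ((eventually_gt_nhds ht).mono hh.continuousAt)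
  exact this.congr_of_eventuallyEq (Eventually.of_forall fun x => rlIntegral_one h x)

/-- By the semigroup law `I^b h` is the primitive of `I^(b-1) h`, which is continuous since `b - 1 ≥
1`. -/
theorem hasDerivAt_rlIntegral {b : ℝ} (hb : 2 ≤ b) {h : ℝ → ℝ} (hh : RLAdmissible h) {t : ℝ}
    (ht : 0 < t) : HasDerivAt (rlIntegral b h) (rlIntegral (b - 1) h t) t := by
  have hcont := continuousOn_rlIntegral (b := b - 1) (by linarith) hh
  have := hasDerivAt_integral_of_continuousAt
    (intervalIntegrable_rlIntegral (b := b - 1) (by linarith) ht.le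
      (hh.intervalIntegrable t ht.le))
    ((eventually_gt_nhds ht).mono fun x hx => hcont.continuousAt (Ici_mem_nhds hx))
  refine this.congr_of_eventuallyEq ((eventually_gt_nhds ht).mono fun x hx => ?_)
  have := rlIntegral_add_one_eq (b := b - 1) (by linarith) hh hx.le
  rwa [sub_add_cancel] at this

theorem intervalIntegrable_sub_rpow_mul {b t : ℝ} (hb : 0 < b) (ht : 0 ≤ t) {h : ℝ → ℝ}
    (hh : ContinuousOn h (Icc 0 t)) :
    IntervalIntegrable (fun s => (t - s) ^ (b - 1) * h s) volume 0 t := by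
  have h1 : IntervalIntegrable (fun s : ℝ => s ^ (b - 1)) volume t 0 :=
    intervalIntegral.intervalIntegrable_rpow' (by linarith)
  have h2 := h1.comp_sub_left t
  simp only [sub_self, sub_zero] at h2
  exact h2.mul_continuousOn (by rwa [uIcc_of_le ht])

theorem rlIntegral_add_fun {b t : ℝ} (hb : 0 < b) (ht : 0 ≤ t) {h k : ℝ → ℝ}
    (hh : ContinuousOn h (Icc 0 t)) (hk : ContinuousOn k (Icc 0 t)) :
    rlIntegral b (fun s => h s + k s) t = rlIntegral b h t + rlIntegral b k t := by
  simp only [rlIntegral, mul_add]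
  rw [intervalIntegral.integral_add (intervalIntegrable_sub_rpow_mul hb ht hh)
    (intervalIntegrable_sub_rpow_mul hb ht hk), mul_add]

theorem rlIntegral_const_mul_fun {b t : ℝ} (c : ℝ) (h : ℝ → ℝ) :
    rlIntegral b (fun s => c * h s) t = c * rlIntegral b h t := by
  simp only [rlIntegral, mul_left_comm _ c]
  rw [intervalIntegral.integral_const_mul, mul_left_comm]

theorem rlIntegral_sum_fun {ι : Type*} (S : Finset ι) {b t : ℝ} (hb : 0 < b) (ht : 0 ≤ t)
    {h : ι → ℝ → ℝ} (hh : ∀ i ∈ S, ContinuousOn (h i) (Icc 0 t)) :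
    rlIntegral b (fun s => ∑ i ∈ S, h i s) t = ∑ i ∈ S, rlIntegral b (h i) t := by
  simp only [rlIntegral, Finset.mul_sum]
  rw [intervalIntegral.integral_finsetSum fun i hi =>
    intervalIntegrable_sub_rpow_mul hb ht (hh i hi), Finset.mul_sum]

theorem RLAdmissible.of_continuous {h : ℝ → ℝ} (hh : Continuous h) : RLAdmissible h :=
  ⟨fun t _ => hh.intervalIntegrable 0 t, fun _ _ => hh.continuousAt⟩

theorem hasDerivWithinAt_rlIntegral_zero {b : ℝ} (hb : 2 ≤ b) {h : ℝ → ℝ}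
    (hh : RLAdmissible h) : HasDerivWithinAt (rlIntegral b h) 0 (Ici 0) 0 := by
  refine hasDerivWithinAt_Ici_of_tendsto_deriv (s := Ioi 0)
    (fun x hx => (hasDerivAt_rlIntegral hb hh hx).differentiableAt.differentiableWithinAt)
    ((continuousOn_rlIntegral (by linarith) hh 0 self_mem_Ici).mono Ioi_subset_Ici_self)
    self_mem_nhdsWithin ?_
  have h1 := (continuousOn_rlIntegral (b := b - 1) (by linarith) hh 0 self_mem_Ici).mono
    Ioi_subset_Ici_self
  rw [ContinuousWithinAt, rlIntegral_zero_right] at h1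
  refine h1.congr' ?_
  filter_upwards [self_mem_nhdsWithin] with x hx
  exact (hasDerivAt_rlIntegral hb hh hx).deriv.symm

/-- The fractional integral of a bounded function vanishes at the origin. -/
theorem tendsto_rlIntegral_zero {b : ℝ} (hb : 0 < b) {h : ℝ → ℝ} (hh : Continuous h) :
    Tendsto (rlIntegral b h) (𝓝[>] 0) (𝓝 0) := by
  obtain ⟨M, hM⟩ := isCompact_Icc.exists_bound_of_continuousOn (s := Icc (0 : ℝ) 1)
    hh.continuousOn
  -- The majorant is `M · I^b 1`, written as `rlIntegral_rpow` gives it for exponent `0`.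
  have hlim : Tendsto (fun t : ℝ => M * (Real.Gamma (0 + 1) / Real.Gamma (0 + 1 + b) * t ^ (0 + b)))
      (𝓝[>] 0) (𝓝 0) := by
    have h1 : Continuous fun t : ℝ => t ^ (0 + b) := Real.continuous_rpow_const (by linarith)
    have h2 : Continuous fun t : ℝ =>
        M * (Real.Gamma (0 + 1) / Real.Gamma (0 + 1 + b) * t ^ (0 + b)) := by fun_prop
    have h3 := h2.tendsto 0
    rw [Real.zero_rpow (by linarith : 0 + b ≠ 0), mul_zero, mul_zero] at h3
    exact h3.mono_left nhdsWithin_le_nhds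
  refine squeeze_zero_norm' ?_ hlim
  filter_upwards [Ioo_mem_nhdsGT (zero_lt_one' ℝ)] with t ht
  rw [← rlIntegral_rpow hb (by norm_num) ht.1, ← rlIntegral_const_mul_fun]
  have g := Real.Gamma_pos_of_pos hb
  simp only [rlIntegral, Real.rpow_zero]
  rw [norm_mul, Real.norm_of_nonneg (one_div_pos.2 g).le]
  refine mul_le_mul_of_nonneg_left ?_ (one_div_pos.2 g).le
  refine intervalIntegral.norm_integral_le_of_norm_le ht.1.le ?_
    (intervalIntegrable_sub_rpow_mul hb ht.1.le continuousOn_const)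
  refine Eventually.of_forall fun s hs => ?_
  have h4 : 0 ≤ (t - s) ^ (b - 1) := Real.rpow_nonneg (sub_nonneg.2 hs.2) _
  rw [norm_mul, Real.norm_of_nonneg h4, mul_one]
  exact mul_le_mul_of_nonneg_left (hM s ⟨hs.1.le, hs.2.trans ht.2.le⟩) h4

/-! ### Inverting the Riemann–Liouville derivative. -/

section Chain

variable {s : Set ℝ} {n : ℕ} {W : ℕ → ℝ → ℝ}

theorem eqOn_iteratedDeriv_of_chain (hs : IsOpen s)
    (hW : ∀ k < n, ∀ t ∈ s, HasDerivAt (W k) (W (k + 1) t) t) :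
    ∀ k ≤ n, EqOn (iteratedDeriv k (W 0)) (W k) s := by
  intro k
  induction k with
  | zero => intro _ t _; simp
  | succ k ih =>
    intro hk t ht
    rw [iteratedDeriv_succ]
    have : iteratedDeriv k (W 0) =ᶠ[𝓝 t] W k :=
      (ih (by omega)).eventuallyEq_of_mem (hs.mem_nhds ht)
    rw [this.deriv_eq, (hW k (by omega) t ht).deriv]

theorem differentiableAt_iteratedDeriv_of_chain (hs : IsOpen s)
    (hW : ∀ k < n, ∀ t ∈ s, HasDerivAt (W k) (W (k + 1) t) t) :
    ∀ k < n, ∀ t ∈ s, DifferentiableAt ℝ (iteratedDeriv k (W 0)) t := by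
  intro k hk t ht
  have : iteratedDeriv k (W 0) =ᶠ[𝓝 t] W k :=
    (eqOn_iteratedDeriv_of_chain hs hW k hk.le).eventuallyEq_of_mem (hs.mem_nhds ht)
  exact this.differentiableAt_iff.2 (hW k hk t ht).differentiableAt

/-- Induction on the length: the shifted chain makes `W 1` a polynomial, and `W 0` minus an
antiderivative of it has zero derivative on a connected open set. No continuity of the top
derivative is needed. -/
theorem eq_sum_pow_of_chain (hs : IsOpen s) (hs' : IsPreconnected s) :
    ∀ {n : ℕ} {W : ℕ → ℝ → ℝ}, (∀ k < n, ∀ t ∈ s, HasDerivAt (W k) (W (k + 1) t) t) →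
      (∀ t ∈ s, W n t = 0) →
      ∃ c : ℕ → ℝ, ∀ t ∈ s, W 0 t = ∑ k ∈ Finset.range n, c k * t ^ k := by
  intro n
  induction n with
  | zero => intro W _ h0; exact ⟨0, fun t ht => by simpa using h0 t ht⟩
  | succ n ih =>
    intro W hW h0
    obtain ⟨c, hc⟩ := ih (W := fun k => W (k + 1)) (fun k hk => hW (k + 1) (by omega)) h0
    have hP : ∀ t, HasDerivAt
        (fun t => ∑ k ∈ Finset.range n, c k / ((k : ℝ) + 1) * t ^ (k + 1))
        (∑ k ∈ Finset.range n, c k * t ^ k) t := by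
      intro t
      refine HasDerivAt.fun_sum fun k _ => ?_
      refine ((hasDerivAt_pow (k + 1) t).const_mul (c k / ((k : ℝ) + 1))).congr_deriv ?_
      have : (k : ℝ) + 1 ≠ 0 := by positivity
      push_cast
      field_simp
    have hD : ∀ t ∈ s, HasDerivAt
        (fun t => W 0 t - ∑ k ∈ Finset.range n, c k / ((k : ℝ) + 1) * t ^ (k + 1)) 0 t := by
      intro t ht
      have := (hW 0 (by omega) t ht).sub (hP t)
      rw [show W (0 + 1) t = _ from hc t ht, sub_self] at this
      exact this
    obtain ⟨a, ha⟩ := hs.exists_is_const_of_deriv_eq_zero hs'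
      (fun t ht => (hD t ht).differentiableAt.differentiableWithinAt)
      (fun t ht => (hD t ht).deriv)
    -- Degree `0` carries the constant of integration; the other coefficients are those of the
    -- antiderivative.
    refine ⟨fun k => if k = 0 then a else c (k - 1) / (((k - 1 : ℕ) : ℝ) + 1), fun t ht => ?_⟩
    rw [Finset.sum_range_succ']
    have := ha t ht
    simp only [Nat.add_eq_zero_iff, one_ne_zero, and_false, if_false, Nat.add_sub_cancel, if_true,
      pow_zero, mul_one]
    linarith

end Chain

/-- The successive derivatives of the `n`-fold integral of `h`. -/
def primitiveChain (n : ℕ) (h : ℝ → ℝ) (k : ℕ) : ℝ → ℝ :=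
  if k < n then rlIntegral ((n : ℝ) - k) h else h

theorem hasDerivAt_primitiveChain {n : ℕ} {h : ℝ → ℝ} (hh : RLAdmissible h) {k : ℕ} (hk : k < n)
    {t : ℝ} (ht : 0 < t) :
    HasDerivAt (primitiveChain n h k) (primitiveChain n h (k + 1) t) t := by
  simp only [primitiveChain, if_pos hk]
  split_ifs with h1
  · have h2 : ((k + 1 + 1 : ℕ) : ℝ) ≤ n := Nat.cast_le.2 h1
    push_cast at h2
    have := hasDerivAt_rlIntegral (b := (n : ℝ) - k) (by linarith) hh ht
    convert this using 2
    push_cast; ring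
  · have h2 : n = k + 1 := by omega
    have h3 : (n : ℝ) - k = 1 := by rw [h2]; push_cast; ring
    rw [h3]
    exact hasDerivAt_rlIntegral_one hh ht

theorem rlOrder_sub_mem {α : ℝ} (hα : 0 < α) : (rlOrder α : ℝ) - α ∈ Ioc (0 : ℝ) 1 := by
  have h1 := Nat.floor_le hα.le
  have h2 := Nat.lt_floor_add_one α
  simp only [rlOrder, mem_Ioc]
  push_cast
  constructor <;> linarith

/-- The derivatives of `I^(n-α) v` minus those of the `n`-fold primitive of `h` form a chain whose
last term is `D^α v - h = 0`. -/
theorem rlIntegral_eq_add_sum_pow {α : ℝ} {h v : ℝ → ℝ} (hh : RLAdmissible h)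
    (hv : RLDifferentiableOn α v (Ioo 0 1)) (heq : ∀ t ∈ Ioo (0 : ℝ) 1, rlDeriv α v t = h t) :
    ∃ c : ℕ → ℝ, ∀ t ∈ Ioo (0 : ℝ) 1, rlIntegral ((rlOrder α : ℝ) - α) v t
      = rlIntegral (rlOrder α) h t + ∑ k ∈ Finset.range (rlOrder α), c k * t ^ k := by
  have hn : 0 < rlOrder α := Nat.succ_pos _
  obtain ⟨c, hc⟩ := eq_sum_pow_of_chain (s := Ioo (0 : ℝ) 1) isOpen_Ioo isPreconnected_Ioo
    (n := rlOrder α)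
    (W := fun k t => iteratedDeriv k (rlIntegral ((rlOrder α : ℝ) - α) v) t
      - primitiveChain (rlOrder α) h k t)
    (fun k hk t ht => by
      have h1 := (hv k hk t ht).hasDerivAt
      rw [← iteratedDeriv_succ] at h1
      exact h1.sub (hasDerivAt_primitiveChain hh hk ht.1))
    (fun t ht => by
      simp only [primitiveChain, lt_irrefl, if_false]
      exact sub_eq_zero.2 (heq t ht))
  refine ⟨c, fun t ht => ?_⟩
  have := hc t ht
  simp only [iteratedDeriv_zero, primitiveChain, hn, if_true, Nat.cast_zero, sub_zero] at this
  linarith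

theorem eqOn_deriv_of_eqOn {s : Set ℝ} (hs : IsOpen s) {f g f' g' : ℝ → ℝ} (h : EqOn f g s)
    (hf : ∀ t ∈ s, HasDerivAt f (f' t) t) (hg : ∀ t ∈ s, HasDerivAt g (g' t) t) :
    EqOn f' g' s := fun t ht =>
  (hf t ht).unique ((hg t ht).congr_of_eventuallyEq (h.eventuallyEq_of_mem (hs.mem_nhds ht)))

theorem hasDerivAt_rlIntegral_add_sum_rpow {ι : Type*} (S : Finset ι) {b : ℝ} (hb : 2 ≤ b)
    {h : ℝ → ℝ} (hh : RLAdmissible h) (c e : ι → ℝ) {t : ℝ} (ht : 0 < t) :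
    HasDerivAt (fun t => rlIntegral b h t + ∑ k ∈ S, c k * t ^ e k)
      (rlIntegral (b - 1) h t + ∑ k ∈ S, c k * e k * t ^ (e k - 1)) t := by
  refine (hasDerivAt_rlIntegral hb hh ht).add (HasDerivAt.fun_sum fun k _ => ?_)
  rw [mul_assoc]
  exact (Real.hasDerivAt_rpow_const (Or.inl ht.ne')).const_mul (c k)

/-- Solutions of `D^α v = h` on `(0, 1)` that are continuous at the origin. -/
theorem eq_rlIntegral_add_sum_rpow {α : ℝ} (hα : 1 ≤ α) {h v : ℝ → ℝ} (hh : RLAdmissible h)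
    (hvc : Continuous v)
    (hv : RLDifferentiableOn α v (Ioo 0 1)) (heq : ∀ t ∈ Ioo (0 : ℝ) 1, rlDeriv α v t = h t) :
    ∃ d : ℕ → ℝ, d 0 = 0 ∧ ∀ t ∈ Ioo (0 : ℝ) 1, v t
      = rlIntegral α h t
        + ∑ k ∈ Finset.range (rlOrder α), d k * t ^ ((k : ℝ) - ((rlOrder α : ℝ) - α)) := by
  obtain ⟨c, hc⟩ := rlIntegral_eq_add_sum_pow hh hv heq
  obtain ⟨hβ0, hβ1⟩ := rlOrder_sub_mem (α := α) (by linarith)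
  have hn : 0 < rlOrder α := Nat.succ_pos _
  set n := rlOrder α with hn_def
  set β := (n : ℝ) - α with hβ
  have hn1 : (1 : ℝ) ≤ n := by exact_mod_cast hn
  -- At the origin both fractional integrals tend to `0`, so the constant term does too; it would
  -- have produced the unbounded power `t^(-β)`.
  have hc0 : c 0 = 0 := by
    have h1 := tendsto_rlIntegral_zero hβ0 hvc
    have h2 : Tendsto (fun t => rlIntegral n h t + ∑ k ∈ Finset.range n, c k * t ^ k)
        (𝓝[>] 0) (𝓝 (0 + ∑ k ∈ Finset.range n, c k * 0 ^ k)) := by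
      refine Tendsto.add ?_ ?_
      · have := (continuousOn_rlIntegral hn1 hh 0 self_mem_Ici).mono Ioi_subset_Ici_self
        rwa [ContinuousWithinAt, rlIntegral_zero_right] at this
      · have : Continuous fun t : ℝ => ∑ k ∈ Finset.range n, c k * t ^ k := by fun_prop
        exact (this.tendsto 0).mono_left nhdsWithin_le_nhds
    have h3 := tendsto_nhds_unique (h1.congr' (by
      filter_upwards [Ioo_mem_nhdsGT (zero_lt_one' ℝ)] with t ht using hc t ht)) h2
    rw [Finset.sum_eq_single_of_mem 0 (Finset.mem_range.2 hn)
      (fun k _ hk => by simp [hk])] at h3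
    simpa using h3.symm
  set e : ℕ → ℝ := fun k => c k * (Real.Gamma (k + 1) / Real.Gamma (k + 1 + (2 - β))) with he
  have hva := RLAdmissible.of_continuous hvc
  -- Raising to total order `2` rather than `1` keeps `2 - β` positive even when `α` is an integer
  -- and `β = 1`.
  have hE : EqOn (rlIntegral 2 v) (fun t => rlIntegral (α + 2) h t
      + ∑ k ∈ Finset.range n, e k * t ^ ((k : ℝ) + (2 - β))) (Ioo 0 1) := by
    intro t ht
    have h1 := rlIntegral_rlIntegral (a := 2 - β) (b := β) (by linarith) hβ0 (by linarith)
      ht.1.le (hva.intervalIntegrable t ht.1.le)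
    rw [sub_add_cancel] at h1
    rw [← h1, rlIntegral_congr ht.1.le
      (fun s hs => hc s ⟨hs.1, hs.2.trans ht.2⟩),
      rlIntegral_add_fun (by linarith) ht.1.le
        ((continuousOn_rlIntegral hn1 hh).mono Icc_subset_Ici_self) (by fun_prop),
      rlIntegral_sum_fun _ (by linarith) ht.1.le (fun k _ => by fun_prop),
      rlIntegral_rlIntegral (by linarith) (by linarith) (by linarith) ht.1.le
        (hh.intervalIntegrable t ht.1.le)]
    congr 1
    · congr 1; rw [hβ]; ring
    · refine Finset.sum_congr rfl fun k _ => ?_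
      rw [rlIntegral_const_mul_fun, he, mul_assoc]
      have hk : (-1 : ℝ) < k := by linarith [Nat.cast_nonneg (α := ℝ) k]
      rw [← rlIntegral_rpow (by linarith) hk ht.1]
      simp only [Real.rpow_natCast]
  have hE1 := eqOn_deriv_of_eqOn isOpen_Ioo hE
    (fun t ht => hasDerivAt_rlIntegral le_rfl hva ht.1)
    (fun t ht => hasDerivAt_rlIntegral_add_sum_rpow _ (by linarith) hh _ _ ht.1)
  rw [show (2 : ℝ) - 1 = 1 by norm_num, show α + 2 - 1 = α + 1 by ring] at hE1
  have hE2 := eqOn_deriv_of_eqOn isOpen_Ioo hE1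
    (fun t ht => hasDerivAt_rlIntegral_one hva ht.1)
    (fun t ht => hasDerivAt_rlIntegral_add_sum_rpow _ (by linarith) hh _ _ ht.1)
  refine ⟨fun k => e k * (k + (2 - β)) * (k + (2 - β) - 1), ?_, fun t ht => (hE2 ht).trans ?_⟩
  · simp [he, hc0]
  · rw [add_sub_cancel_right]
    refine congrArg (_ + ·) (Finset.sum_congr rfl fun k _ => ?_)
    congr 2
    ring

/-! ### The Green function and its integral operator. -/

theorem green_eq_max {α : ℝ} (hα : 1 < α) (t s : ℝ) :
    green α t s = ((max (t - s) 0) ^ (α - 1) +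
      (1 - s) ^ (α - 2) * t ^ (α - 2) * ((s - t) + (α - 2) * (1 - t) * s)) / Real.Gamma α := by
  unfold green
  split_ifs with h
  · rw [max_eq_left (sub_nonneg.2 h)]
  · rw [max_eq_right (by linarith), Real.zero_rpow (by linarith), zero_add]

theorem continuous_green {α : ℝ} (hα : 2 ≤ α) : Continuous fun p : ℝ × ℝ => green α p.1 p.2 := by
  simp only [green_eq_max (show 1 < α by linarith)]
  have h1 : Continuous fun x : ℝ => x ^ (α - 1) := Real.continuous_rpow_const (by linarith)
  have h2 : Continuous fun x : ℝ => x ^ (α - 2) := Real.continuous_rpow_const (by linarith)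
  have h3 : Continuous fun p : ℝ × ℝ => (max (p.1 - p.2) 0) ^ (α - 1) := h1.comp (by fun_prop)
  have h4 : Continuous fun p : ℝ × ℝ => (1 - p.2) ^ (α - 2) := h2.comp (by fun_prop)
  have h5 : Continuous fun p : ℝ × ℝ => p.1 ^ (α - 2) := h2.comp (by fun_prop)
  fun_prop

/-- Bernoulli for `(x/y)^p` bounds `y^p - x^p` by `p y^p (y-x)/y`; the extra factor `x ≤ y` absorbs
the denominator. -/
theorem rpow_sub_rpow_le {p x y : ℝ} (hp : 1 ≤ p) (hx : 0 ≤ x) (hxy : x ≤ y) :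
    x * (y ^ p - x ^ p) ≤ p * y ^ p * (y - x) := by
  rcases hx.eq_or_lt with rfl | hx
  · rw [zero_mul, sub_zero]; positivity
  have hy : 0 < y := hx.trans_le hxy
  have hB := one_add_mul_self_le_rpow_one_add (s := x / y - 1) (p := p)
    (by have := div_pos hx hy; linarith) hp
  rw [add_sub_cancel, Real.div_rpow hx.le hy.le, le_div_iff₀ (by positivity)] at hB
  have h1 : y ^ p - x ^ p ≤ p * y ^ p * ((y - x) / y) := by
    have : (y - x) / y = 1 - x / y := by field_simp
    rw [this]; linarith
  calc x * (y ^ p - x ^ p) ≤ x * (p * y ^ p * ((y - x) / y)) := by gcongr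
    _ = (x / y) * (p * y ^ p * (y - x)) := by ring
    _ ≤ 1 * (p * y ^ p * (y - x)) := by
        have : 0 ≤ y - x := sub_nonneg.2 hxy
        gcongr
        exact (div_le_one hy).2 hxy
    _ = _ := one_mul _

theorem green_nonneg {α t s : ℝ} (hα : 3 ≤ α) (ht : t ∈ Icc (0 : ℝ) 1) (hs : s ∈ Icc (0 : ℝ) 1) :
    0 ≤ green α t s := by
  obtain ⟨ht0, ht1⟩ := ht
  obtain ⟨hs0, hs1⟩ := hs
  have g := Real.Gamma_pos_of_pos (by linarith : 0 < α)
  have h1s : 0 ≤ 1 - s := by linarith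
  have h1t : 0 ≤ 1 - t := by linarith
  have hα2 : 0 ≤ α - 2 := by linarith
  unfold green
  split_ifs with h
  · refine div_nonneg ?_ g.le
    rw [← Real.mul_rpow h1s ht0]
    -- With `x = t - s`, `y = (1-s)t` one has `y - x = (1-t)s`, and `Γ(α) G` becomes `(α-2) y^(α-2)
    -- (y-x) - x (y^(α-2) - x^(α-2))`.
    have hB : 0 ≤ t - s := sub_nonneg.2 h
    have hAB : t - s ≤ (1 - s) * t := by nlinarith
    have key := rpow_sub_rpow_le (p := α - 2) (by linarith) hB hAB
    have e : (t - s) ^ (α - 1) = (t - s) * (t - s) ^ (α - 2) := by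
      rw [mul_comm, ← Real.rpow_add_one' hB (by linarith)]; congr 1; ring
    rw [e]
    have e2 : (1 - s) * t - (t - s) = (1 - t) * s := by ring
    rw [e2] at key
    nlinarith
  · refine div_nonneg ?_ g.le
    have : 0 ≤ s - t := by linarith
    positivity

theorem green_pos {α t s : ℝ} (hα : 2 ≤ α) (ht : 0 < t) (hts : t < s) (hs : s < 1) :
    0 < green α t s := by
  have g := Real.Gamma_pos_of_pos (by linarith : 0 < α)
  rw [green, if_neg (not_le.2 hts)]
  have h1 : 0 < 1 - s := by linarith
  have h2 : 0 < s - t := by linarith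
  have h3 : 0 ≤ (α - 2) * (1 - t) * s := by
    have : 0 ≤ 1 - t := by linarith
    have : 0 ≤ α - 2 := by linarith
    have : 0 ≤ s := by linarith
    positivity
  positivity

/-- The integral operator with kernel `green α`. -/
def greenOp (α : ℝ) (h : ℝ → ℝ) (t : ℝ) : ℝ := ∫ s in (0 : ℝ)..1, green α t s * h s

theorem intervalIntegrable_green_mul {α : ℝ} (hα : 2 ≤ α) {h : ℝ → ℝ} (hh : RLAdmissible h)
    (t : ℝ) : IntervalIntegrable (fun s => green α t s * h s) volume 0 1 := by
  have h1 : Continuous fun s => green α t s :=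
    (continuous_green hα).comp (by fun_prop : Continuous fun s : ℝ => (t, s))
  exact (hh.intervalIntegrable 1 zero_le_one).continuousOn_mul h1.continuousOn

theorem continuousOn_greenOp {α : ℝ} (hα : 2 ≤ α) {h : ℝ → ℝ} (hh : RLAdmissible h) :
    ContinuousOn (greenOp α h) (Icc 0 1) := by
  rw [continuousOn_iff_continuous_domRestrict]
  obtain ⟨M, hM⟩ := (isCompact_Icc.prod isCompact_Icc).exists_bound_of_continuousOn
    (s := Icc (0 : ℝ) 1 ×ˢ Icc (0 : ℝ) 1) (continuous_green hα).continuousOn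
  refine intervalIntegral.continuous_of_dominated_interval
    (F := fun (t : Icc (0 : ℝ) 1) s => green α t s * h s) (bound := fun s => M * |h s|)
    (fun t => ?_) (fun t => ?_) ?_ ?_
  · exact (intervalIntegrable_iff.1
      (intervalIntegrable_green_mul hα hh t)).aestronglyMeasurable
  · refine Eventually.of_forall fun s hs => ?_
    rw [uIoc_of_le zero_le_one] at hs
    rw [norm_mul, Real.norm_eq_abs (h s)]
    exact mul_le_mul_of_nonneg_right (hM (t, s) ⟨t.2, hs.1.le, hs.2⟩) (abs_nonneg _)
  · exact (hh.intervalIntegrable 1 zero_le_one).abs.const_mul M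
  · refine Eventually.of_forall fun s _ => ?_
    exact ((continuous_green hα).comp (by fun_prop :
      Continuous fun t : Icc (0 : ℝ) 1 => ((t : ℝ), s))).mul continuous_const

theorem integral_max_sub_rpow_mul {p t : ℝ} (hp : 0 < p) (ht : t ∈ Icc (0 : ℝ) 1) {h : ℝ → ℝ}
    (hh : RLAdmissible h) :
    ∫ s in (0 : ℝ)..1, (max (t - s) 0) ^ p * h s = ∫ s in (0 : ℝ)..t, (t - s) ^ p * h s := by
  have hc : Continuous fun s : ℝ => (max (t - s) 0) ^ p :=
    (Real.continuous_rpow_const hp.le).comp (by fun_prop)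
  have hi := (hh.intervalIntegrable 1 zero_le_one).continuousOn_mul hc.continuousOn
  have hsub : ∀ a ∈ Icc (0 : ℝ) 1, ∀ b ∈ Icc (0 : ℝ) 1,
      IntervalIntegrable (fun s => (max (t - s) 0) ^ p * h s) volume a b := fun a ha b hb =>
    hi.mono_set (by rw [uIcc_of_le zero_le_one]; exact ordConnected_Icc.uIcc_subset ha hb)
  rw [← intervalIntegral.integral_add_adjacent_intervals
    (hsub 0 (by simp) t ht) (hsub t ht 1 (by simp))]
  have h1 : ∫ s in t..1, (max (t - s) 0) ^ p * h s = ∫ s in t..1, (0 : ℝ) := by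
    refine intervalIntegral.integral_congr fun s hs => ?_
    rw [uIcc_of_le ht.2] at hs
    rw [max_eq_right (by linarith [hs.1]), Real.zero_rpow hp.ne', zero_mul]
  rw [h1, intervalIntegral.integral_zero, add_zero]
  refine intervalIntegral.integral_congr fun s hs => ?_
  rw [uIcc_of_le ht.1] at hs
  rw [max_eq_left (by linarith [hs.2])]

/-- The functions `I^α h + a t^(α-1) + b t^(α-2)`. -/
def rlAffine (α : ℝ) (h : ℝ → ℝ) (a b t : ℝ) : ℝ :=
  rlIntegral α h t + a * t ^ (α - 1) + b * t ^ (α - 2)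

/-- The bracket in `G` equals `(α-1)(1-t) - (1+(α-2)(1-t))(1-s)`, so the `s`-integrals reduce to
`I^(α-1) h` and `I^α h` at `1`. The resulting coefficients are those that make value and derivative
vanish at `1`. -/
theorem greenOp_eq_rlAffine {α : ℝ} (hα : 3 ≤ α) {h : ℝ → ℝ} (hh : RLAdmissible h) {t : ℝ}
    (ht : t ∈ Icc (0 : ℝ) 1) :
    greenOp α h t = rlAffine α h
      ((α - 2) * rlIntegral α h 1 - rlIntegral (α - 1) h 1)
      (rlIntegral (α - 1) h 1 - (α - 1) * rlIntegral α h 1) t := by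
  have hG : Real.Gamma α = (α - 1) * Real.Gamma (α - 1) := by
    have := Real.Gamma_add_one (s := α - 1) (by linarith)
    rwa [sub_add_cancel] at this
  have g1 := (Real.Gamma_pos_of_pos (by linarith : 0 < α - 1)).ne'
  have hα1 : α - 1 ≠ 0 := by linarith
  have hi1 := hh.intervalIntegrable 1 zero_le_one
  have hc : ∀ p : ℝ, 0 ≤ p → IntervalIntegrable (fun s => (1 - s) ^ p * h s) volume 0 1 := by
    intro p hp
    have h1 : Continuous fun s : ℝ => (1 - s) ^ p :=
      (Real.continuous_rpow_const hp).comp (by fun_prop)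
    exact hi1.continuousOn_mul h1.continuousOn
  have hm : IntervalIntegrable (fun s => (max (t - s) 0) ^ (α - 1) * h s) volume 0 1 := by
    have h1 : Continuous fun s : ℝ => (max (t - s) 0) ^ (α - 1) :=
      (Real.continuous_rpow_const (by linarith)).comp (by fun_prop)
    exact hi1.continuousOn_mul h1.continuousOn
  have e : greenOp α h t = ∫ s in (0 : ℝ)..1, (1 / Real.Gamma α) *
      ((max (t - s) 0) ^ (α - 1) * h s + (t ^ (α - 2) * ((1 - t) * (α - 1)) *
        ((1 - s) ^ (α - 2) * h s) - t ^ (α - 2) * (1 + (α - 2) * (1 - t)) *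
        ((1 - s) ^ (α - 1) * h s))) := by
    refine intervalIntegral.integral_congr fun s hs => ?_
    rw [uIcc_of_le zero_le_one] at hs
    have hp : (1 - s) ^ (α - 1) = (1 - s) ^ (α - 2) * (1 - s) := by
      rw [← Real.rpow_add_one' (by linarith [hs.2]) (by linarith)]; congr 1; ring
    rw [green_eq_max (by linarith), hp]
    ring
  have hpt : t ^ (α - 1) = t ^ (α - 2) * t := by
    rw [← Real.rpow_add_one' ht.1 (by linarith)]; congr 1; ring
  rw [e, intervalIntegral.integral_const_mul, intervalIntegral.integral_add hm
    (((hc _ (by linarith)).const_mul _).sub ((hc _ (by linarith)).const_mul _)),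
    intervalIntegral.integral_sub ((hc _ (by linarith)).const_mul _)
      ((hc _ (by linarith)).const_mul _), intervalIntegral.integral_const_mul,
    intervalIntegral.integral_const_mul, integral_max_sub_rpow_mul (by linarith) ht hh,
    rlAffine, rlIntegral, rlIntegral, rlIntegral, hG, hpt, show α - 1 - 1 = α - 2 by ring]
  field_simp
  ring

/-! ### The linear boundary value problem. -/

section RLAffine

variable {α : ℝ} {h : ℝ → ℝ} {a b : ℝ}

theorem continuousOn_rlAffine (hα : 3 ≤ α) (hh : RLAdmissible h) :
    ContinuousOn (rlAffine α h a b) (Ici 0) := by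
  have h1 : Continuous fun t : ℝ => t ^ (α - 1) := Real.continuous_rpow_const (by linarith)
  have h2 : Continuous fun t : ℝ => t ^ (α - 2) := Real.continuous_rpow_const (by linarith)
  exact ((continuousOn_rlIntegral (by linarith) hh).add
    (continuous_const.mul h1).continuousOn).add (continuous_const.mul h2).continuousOn

theorem rlAffine_zero (hα : 3 ≤ α) : rlAffine α h a b 0 = 0 := by
  rw [rlAffine, rlIntegral_zero_right, Real.zero_rpow (by linarith), Real.zero_rpow (by linarith)]
  ring

theorem rlAffine_one : rlAffine α h a b 1 = rlIntegral α h 1 + a + b := by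
  simp [rlAffine]

theorem hasDerivAt_rlAffine_one (hα : 3 ≤ α) (hh : RLAdmissible h) :
    HasDerivAt (rlAffine α h a b)
      (rlIntegral (α - 1) h 1 + a * (α - 1) + b * (α - 2)) 1 := by
  have h1 := hasDerivAt_rlIntegral (by linarith : 2 ≤ α) hh zero_lt_one
  have h2 := (Real.hasDerivAt_rpow_const (x := 1) (p := α - 1) (Or.inl one_ne_zero)).const_mul a
  have h3 := (Real.hasDerivAt_rpow_const (x := 1) (p := α - 2) (Or.inl one_ne_zero)).const_mul b
  refine ((h1.add h2).add h3).congr_deriv ?_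
  simp

theorem hasDerivWithinAt_rlAffine_zero (hα : 3 < α) (hh : RLAdmissible h) :
    HasDerivWithinAt (rlAffine α h a b) 0 (Ici 0) 0 := by
  have h1 := hasDerivWithinAt_rlIntegral_zero (by linarith : 2 ≤ α) hh
  have h2 := ((Real.hasDerivAt_rpow_const (x := 0) (p := α - 1)
    (Or.inr (by linarith))).const_mul a).hasDerivWithinAt (s := Ici 0)
  have h3 := ((Real.hasDerivAt_rpow_const (x := 0) (p := α - 2)
    (Or.inr (by linarith))).const_mul b).hasDerivWithinAt (s := Ici 0)
  refine ((h1.add h2).add h3).congr_deriv ?_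
  rw [Real.zero_rpow (by linarith), Real.zero_rpow (by linarith)]
  ring

/-- The fractional integral of order `n - α` of `rlAffine`. -/
theorem rlIntegral_rlAffine (hα : 3 ≤ α) (hh : RLAdmissible h) {n : ℕ} (hn : 2 ≤ n)
    (hβ : 0 < (n : ℝ) - α) :
    ∃ a' b' : ℝ, ∀ t, 0 < t → rlIntegral ((n : ℝ) - α) (rlAffine α h a b) t
      = rlIntegral n h t + a' * t ^ (n - 1) + b' * t ^ (n - 2) := by
  refine ⟨a * (Real.Gamma (α - 1 + 1) / Real.Gamma (α - 1 + 1 + ((n : ℝ) - α))),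
    b * (Real.Gamma (α - 2 + 1) / Real.Gamma (α - 2 + 1 + ((n : ℝ) - α))), fun t ht => ?_⟩
  have h1 : Continuous fun t : ℝ => a * t ^ (α - 1) :=
    continuous_const.mul (Real.continuous_rpow_const (by linarith))
  have h2 : Continuous fun t : ℝ => b * t ^ (α - 2) :=
    continuous_const.mul (Real.continuous_rpow_const (by linarith))
  have h0 : ContinuousOn (rlIntegral α h) (Icc 0 t) :=
    (continuousOn_rlIntegral (by linarith) hh).mono Icc_subset_Ici_self
  unfold rlAffine
  rw [rlIntegral_add_fun (h := fun t => rlIntegral α h t + a * t ^ (α - 1)) hβ ht.le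
      (h0.add h1.continuousOn) h2.continuousOn,
    rlIntegral_add_fun hβ ht.le h0 h1.continuousOn, rlIntegral_const_mul_fun,
    rlIntegral_const_mul_fun, rlIntegral_rpow hβ (by linarith) ht,
    rlIntegral_rpow hβ (by linarith) ht,
    rlIntegral_rlIntegral hβ (by linarith)
      (by have : (2 : ℝ) ≤ n := by exact_mod_cast hn
          linarith) ht.le (hh.intervalIntegrable t ht.le),
    sub_add_cancel]
  have e1 : α - 1 + ((n : ℝ) - α) = ((n - 1 : ℕ) : ℝ) := by
    rw [Nat.cast_sub (by omega)]; push_cast; ring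
  have e2 : α - 2 + ((n : ℝ) - α) = ((n - 2 : ℕ) : ℝ) := by
    rw [Nat.cast_sub (by omega)]; push_cast; ring
  rw [e1, e2, Real.rpow_natCast, Real.rpow_natCast]
  ring

/-- `I^(n-α)` turns the two powers into monomials of degree below `n`, which `n` derivatives
annihilate, and turns `I^α h` into the `n`-fold primitive of `h`. -/
theorem rlDeriv_eq_of_eqOn_rlAffine (hα : 3 ≤ α) (hh : RLAdmissible h) {u : ℝ → ℝ}
    (hu : EqOn u (rlAffine α h a b) (Ioo 0 1)) :
    RLDifferentiableOn α u (Ioo 0 1) ∧ ∀ t ∈ Ioo (0 : ℝ) 1, rlDeriv α u t = h t := by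
  obtain ⟨hβ, -⟩ := rlOrder_sub_mem (α := α) (by linarith)
  have hn : 2 ≤ rlOrder α := by
    have : (2 : ℝ) ≤ rlOrder α := by linarith
    exact_mod_cast this
  obtain ⟨a', b', hab⟩ := rlIntegral_rlAffine (a := a) (b := b) hα hh hn hβ
  set n := rlOrder α with hn_def
  let P : Polynomial ℝ :=
    Polynomial.C a' * Polynomial.X ^ (n - 1) + Polynomial.C b' * Polynomial.X ^ (n - 2)
  let W : ℕ → ℝ → ℝ := fun k t =>
    primitiveChain n h k t + ((Polynomial.derivative^[k]) P).eval t
  have hW : ∀ k < n, ∀ t ∈ Ioo (0 : ℝ) 1, HasDerivAt (W k) (W (k + 1) t) t := by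
    intro k hk t ht
    refine (hasDerivAt_primitiveChain hh hk ht.1).add ?_
    rw [Function.iterate_succ_apply']
    exact Polynomial.hasDerivAt _ t
  have h0 : EqOn (rlIntegral ((n : ℝ) - α) u) (W 0) (Ioo 0 1) := by
    intro t ht
    rw [rlIntegral_congr ht.1.le (hu.mono (Ioo_subset_Ioo_right ht.2.le)), hab t ht.1]
    simp [W, P, primitiveChain, show 0 < n by omega, add_assoc]
  have hev : ∀ t ∈ Ioo (0 : ℝ) 1, rlIntegral ((n : ℝ) - α) u =ᶠ[𝓝 t] W 0 := fun t ht =>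
    h0.eventuallyEq_of_mem (isOpen_Ioo.mem_nhds ht)
  have hP : (Polynomial.derivative^[n]) P = 0 := by
    refine Polynomial.iterate_derivative_eq_zero ?_
    have : P.natDegree ≤ n - 1 := by
      refine Polynomial.natDegree_add_le_of_degree_le ?_ ?_
      · exact Polynomial.natDegree_C_mul_X_pow_le _ _
      · exact (Polynomial.natDegree_C_mul_X_pow_le _ _).trans (by omega)
    omega
  refine ⟨fun k hk t ht => ?_, fun t ht => ?_⟩
  · exact ((hev t ht).iteratedDeriv k).differentiableAt_iff.2
      (differentiableAt_iteratedDeriv_of_chain isOpen_Ioo hW k hk t ht)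
  · rw [rlDeriv, ← hn_def, (hev t ht).iteratedDeriv_eq n,
      eqOn_iteratedDeriv_of_chain isOpen_Ioo hW n le_rfl ht]
    simp [W, primitiveChain, hP]

end RLAffine

/-- The Riemann–Liouville problem `D^α u = h` with `u` and `u'` vanishing at both end points. -/
structure IsClampedSolution (α : ℝ) (h u : ℝ → ℝ) : Prop where
  continuousOn : ContinuousOn u (Icc 0 1)
  differentiable : RLDifferentiableOn α u (Ioo 0 1)
  equation : ∀ t ∈ Ioo (0 : ℝ) 1, rlDeriv α u t = h t
  left_value : u 0 = 0
  right_value : u 1 = 0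
  left_deriv : HasDerivWithinAt u 0 (Icc 0 1) 0
  right_deriv : HasDerivWithinAt u 0 (Icc 0 1) 1

theorem isClampedSolution_greenOp {α : ℝ} (hα : 3 < α) {h : ℝ → ℝ} (hh : RLAdmissible h) :
    IsClampedSolution α h (greenOp α h) := by
  have hE : EqOn (greenOp α h) _ (Icc 0 1) := fun t ht => greenOp_eq_rlAffine hα.le hh ht
  have hD := rlDeriv_eq_of_eqOn_rlAffine hα.le hh (hE.mono Ioo_subset_Icc_self)
  have m0 : (0 : ℝ) ∈ Icc (0 : ℝ) 1 := by simp
  have m1 : (1 : ℝ) ∈ Icc (0 : ℝ) 1 := by simp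
  refine ⟨continuousOn_greenOp (by linarith) hh, hD.1, hD.2, ?_, ?_, ?_, ?_⟩
  · rw [hE m0, rlAffine_zero hα.le]
  · rw [hE m1, rlAffine_one]; ring
  · exact ((hasDerivWithinAt_rlAffine_zero hα hh).mono Icc_subset_Ici_self).congr_of_mem hE m0
  · refine ((hasDerivAt_rlAffine_one hα.le hh).hasDerivWithinAt.congr_of_mem hE m1).congr_deriv ?_
    ring

theorem rlIntegral_eventuallyEq {b : ℝ} {u v : ℝ → ℝ} (huv : EqOn u v (Ioo 0 1)) {t : ℝ}
    (ht : t ∈ Ioo (0 : ℝ) 1) : rlIntegral b u =ᶠ[𝓝 t] rlIntegral b v := by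
  filter_upwards [isOpen_Ioo.mem_nhds ht] with x hx
  exact rlIntegral_congr hx.1.le (huv.mono (Ioo_subset_Ioo_right hx.2.le))

theorem RLDifferentiableOn.congr {α : ℝ} {u v : ℝ → ℝ} (hu : RLDifferentiableOn α u (Ioo 0 1))
    (huv : EqOn u v (Ioo 0 1)) : RLDifferentiableOn α v (Ioo 0 1) := fun k hk t ht =>
  ((rlIntegral_eventuallyEq huv ht).iteratedDeriv k).differentiableAt_iff.1 (hu k hk t ht)

theorem rlDeriv_congr {α : ℝ} {u v : ℝ → ℝ} (huv : EqOn u v (Ioo 0 1)) {t : ℝ}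
    (ht : t ∈ Ioo (0 : ℝ) 1) : rlDeriv α u t = rlDeriv α v t :=
  (rlIntegral_eventuallyEq huv ht).iteratedDeriv_eq _

/-- The constant `d` is needed only for `α = 4`: there `n = 5` and the exponents are `3, 2, 1, 0`,
while for `α < 4` one has `n = 4` and `α-1, α-2, α-3` exhaust the list. -/
theorem IsClampedSolution.exists_eq_rlAffine_add {α : ℝ} (hα3 : 3 < α) (hα4 : α ≤ 4)
    {h v : ℝ → ℝ} (hh : RLAdmissible h) (hv : IsClampedSolution α h v) :
    ∃ a b c d : ℝ, ∀ t ∈ Ioo (0 : ℝ) 1, v t = rlAffine α h a b t + c * t ^ (α - 3) + d := by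
  have hext : EqOn (IccExtend zero_le_one ((Icc (0 : ℝ) 1).domRestrict v)) v (Icc 0 1) := fun t ht =>
    IccExtend_of_mem _ _ ht
  have hcont : Continuous (IccExtend zero_le_one ((Icc (0 : ℝ) 1).domRestrict v)) :=
    (continuousOn_iff_continuous_domRestrict.1 hv.continuousOn).Icc_extend'
  have hext' := hext.mono Ioo_subset_Icc_self
  obtain ⟨d, hd0, hd⟩ := eq_rlIntegral_add_sum_rpow (by linarith) hh hcont
    (hv.differentiable.congr hext'.symm)
    (fun t ht => by rw [rlDeriv_congr hext' ht, hv.equation t ht])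
  rcases hα4.eq_or_lt with rfl | hα4
  · have hn : rlOrder (4 : ℝ) = 5 := by
      rw [rlOrder, show (4 : ℝ) = ((4 : ℕ) : ℝ) by norm_num, Nat.floor_natCast]
    refine ⟨d 4, d 3, d 2, d 1, fun t ht => ?_⟩
    rw [← hext' ht, hd t ht, hn, rlAffine]
    simp only [Finset.sum_range_succ, Finset.sum_range_zero, hd0]
    norm_num
    ring
  · have hn : rlOrder α = 4 := by
      have : ⌊α⌋₊ = 3 := (Nat.floor_eq_iff (by linarith)).2 ⟨by push_cast; linarith,
        by push_cast; linarith⟩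
      rw [rlOrder, this]
    refine ⟨d 3, d 2, d 1, 0, fun t ht => ?_⟩
    rw [← hext' ht, hd t ht, hn, rlAffine]
    simp only [Finset.sum_range_succ, Finset.sum_range_zero, hd0]
    rw [show α - 1 = ((3 : ℕ) : ℝ) - (((4 : ℕ) : ℝ) - α) by push_cast; ring,
      show α - 2 = ((2 : ℕ) : ℝ) - (((4 : ℕ) : ℝ) - α) by push_cast; ring,
      show α - 3 = ((1 : ℕ) : ℝ) - (((4 : ℕ) : ℝ) - α) by push_cast; ring]
    ring

theorem IsClampedSolution.eqOn_greenOp {α : ℝ} (hα3 : 3 < α) (hα4 : α ≤ 4) {h v : ℝ → ℝ}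
    (hh : RLAdmissible h) (hv : IsClampedSolution α h v) : EqOn v (greenOp α h) (Icc 0 1) := by
  obtain ⟨a, b, c, d, H⟩ := hv.exists_eq_rlAffine_add hα3 hα4 hh
  have m0 : (0 : ℝ) ∈ Icc (0 : ℝ) 1 := by simp
  have m1 : (1 : ℝ) ∈ Icc (0 : ℝ) 1 := by simp
  have hFc : ContinuousOn (rlAffine α h a b) (Icc 0 1) :=
    (continuousOn_rlAffine hα3.le hh).mono Icc_subset_Ici_self
  have hcl : Icc (0 : ℝ) 1 ⊆ closure (Ioo 0 1) := by rw [closure_Ioo zero_ne_one]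
  have hpc : Continuous fun t : ℝ => t ^ (α - 3) := Real.continuous_rpow_const (by linarith)
  have H1 : EqOn v (fun t => rlAffine α h a b t + c * t ^ (α - 3) + d) (Icc 0 1) :=
    EqOn.of_subset_closure (s := Ioo 0 1) H hv.continuousOn
      ((hFc.add (continuous_const.mul hpc).continuousOn).add continuousOn_const)
      Ioo_subset_Icc_self hcl
  have hd : d = 0 := by
    have := H1 m0
    simp only [hv.left_value, rlAffine_zero hα3.le, Real.zero_rpow (by linarith : α - 3 ≠ 0)]
      at this
    linarith
  -- The difference quotient of `v - rlAffine` at `0` is `c t^(α-4)`. It tends to `0`, yet `t^(α-4)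
  -- ≥ 1` on `(0,1)` because `α ≤ 4`.
  have hc : c = 0 := by
    have h1 := hv.left_deriv.sub ((hasDerivWithinAt_rlAffine_zero (a := a) (b := b) hα3 hh).mono
      (fun x (hx : x ∈ Icc (0 : ℝ) 1) => hx.1))
    rw [sub_zero, hasDerivWithinAt_iff_tendsto_slope] at h1
    have h2 : Tendsto (fun t : ℝ => c * t ^ (α - 4)) (𝓝[>] 0) (𝓝 0) := by
      have hm : 𝓝[>] (0 : ℝ) ≤ 𝓝[Icc 0 1 \ {0}] 0 := by
        rw [← nhdsWithin_Ioo_eq_nhdsGT (zero_lt_one' ℝ)]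
        exact nhdsWithin_mono _ fun x hx => ⟨Ioo_subset_Icc_self hx, hx.1.ne'⟩
      refine (h1.mono_left hm).congr' ?_
      filter_upwards [Ioo_mem_nhdsGT (zero_lt_one' ℝ)] with t ht
      have e : t ^ (α - 3) = t ^ (α - 4) * t := by
        rw [← Real.rpow_add_one ht.1.ne']; congr 1; ring
      rw [slope_def_field, Pi.sub_apply, Pi.sub_apply, hv.left_value, rlAffine_zero hα3.le,
        H t ht, hd, e]
      field_simp [ht.1.ne']
      ring
    have h3 : Tendsto (fun t : ℝ => |c * t ^ (α - 4)|) (𝓝[>] 0) (𝓝 0) := by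
      simpa using h2.abs
    have h4 : |c| ≤ 0 := by
      refine ge_of_tendsto h3 ?_
      filter_upwards [Ioo_mem_nhdsGT (zero_lt_one' ℝ)] with t ht
      rw [abs_mul]
      have h5 : 1 ≤ t ^ (α - 4) :=
        Real.one_le_rpow_of_pos_of_le_one_of_nonpos ht.1 ht.2.le (by linarith)
      rw [abs_of_nonneg (by linarith : 0 ≤ t ^ (α - 4))]
      exact le_mul_of_one_le_right (abs_nonneg _) h5
    exact abs_nonpos_iff.1 h4
  have H2 : EqOn v (rlAffine α h a b) (Icc 0 1) := fun t ht => by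
    rw [H1 ht, hc, hd]; ring
  have e1 : rlIntegral α h 1 + a + b = 0 := by
    rw [← rlAffine_one, ← H2 m1, hv.right_value]
  have e2 : rlIntegral (α - 1) h 1 + a * (α - 1) + b * (α - 2) = 0 := by
    have h1 := (hasDerivAt_rlAffine_one (a := a) (b := b) hα3.le hh).hasDerivWithinAt
      (s := Icc 0 1)
    have h2 := hv.right_deriv.congr_of_mem H2.symm m1
    exact (uniqueDiffOn_Icc zero_lt_one 1 m1).eq_deriv _ h1 h2
  intro t ht
  rw [H2 ht, greenOp_eq_rlAffine hα3.le hh ht]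
  congr 1
  -- The system `e1`, `e2` for `a`, `b` has determinant `-1`.
  · linear_combination e2 - (α - 2) * e1
  · linear_combination (α - 1) * e1 - e2

/-! ### The fixed point theorem. -/

/-- A fixed point theorem for contractions of Wardowski type. -/
theorem exists_fixedPoint_of_dist_le {X : Type*} [MetricSpace X] [CompleteSpace X] [Nonempty X]
    {T : X → X} {τ : ℝ} (hτ : 0 < τ)
    (hT : ∀ x y, dist (T x) (T y) ≤ dist x y / (1 + τ * √(dist x y)) ^ 2) :
    ∃ x, T x = x := by
  obtain ⟨x₀⟩ := ‹Nonempty X›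
  have hsqrt : ∀ x y, √(dist (T x) (T y)) * (1 + τ * √(dist x y)) ≤ √(dist x y) := by
    intro x y
    have hp : 0 < 1 + τ * √(dist x y) := by positivity
    rw [← le_div_iff₀ hp]
    refine Real.sqrt_le_iff.2 ⟨by positivity, (hT x y).trans_eq ?_⟩
    rw [div_pow, Real.sq_sqrt dist_nonneg]
  -- This is `1/√d_n ≥ nτ`, gained from `1/√d_(n+1) ≥ 1/√d_n + τ`; the product form also covers
  -- vanishing distances.
  have hd : ∀ n : ℕ, √(dist (T^[n] x₀) (T^[n + 1] x₀)) * (n * τ) ≤ 1 := by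
    intro n
    induction n with
    | zero => simp
    | succ n ih =>
      have h1 := hsqrt (T^[n] x₀) (T^[n + 1] x₀)
      rw [← Function.iterate_succ_apply' T n, ← Function.iterate_succ_apply' T (n + 1)] at h1
      set e := √(dist (T^[n] x₀) (T^[n + 1] x₀))
      set e' := √(dist (T^[n + 1] x₀) (T^[n + 1 + 1] x₀))
      have he : 0 ≤ e := Real.sqrt_nonneg _
      have hp : 0 < 1 + τ * e := by positivity
      have h2 : e' * (1 + τ * e) * ((n + 1) * τ) ≤ 1 * (1 + τ * e) := by
        calc e' * (1 + τ * e) * ((n + 1) * τ) ≤ e * ((n + 1) * τ) := by gcongr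
          _ ≤ 1 * (1 + τ * e) := by linarith
      push_cast
      refine le_of_mul_le_mul_right ?_ hp
      linarith
  have hsum : Summable fun n : ℕ => dist (T^[n] x₀) (T^[n + 1] x₀) := by
    have h1 : Summable fun n : ℕ => 1 / τ ^ 2 * (1 / (n : ℝ) ^ 2) :=
      (Real.summable_one_div_nat_pow.2 (by norm_num)).mul_left _
    refine (summable_nat_add_iff 1).1 (Summable.of_nonneg_of_le (fun _ => dist_nonneg)
      (fun n => ?_) ((summable_nat_add_iff 1).2 h1))
    have h2 := hd (n + 1)
    have hp : 0 < ((n + 1 : ℕ) : ℝ) * τ := by positivity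
    rw [← le_div_iff₀ hp] at h2
    have h3 := (Real.sqrt_le_iff.1 h2).2
    refine h3.trans_eq ?_
    field_simp
  obtain ⟨x, hx⟩ := cauchySeq_tendsto_of_complete (cauchySeq_of_summable_dist hsum)
  have hlip : LipschitzWith 1 T := LipschitzWith.of_dist_le_mul fun x y => by
    rw [NNReal.coe_one, one_mul]
    refine (hT x y).trans (div_le_self dist_nonneg ?_)
    have : 0 ≤ τ * √(dist x y) := by positivity
    nlinarith
  refine ⟨x, tendsto_nhds_unique ?_ ((tendsto_add_atTop_iff_nat 1).2 hx)⟩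
  simp only [Function.iterate_succ_apply']
  exact (hlip.continuous.tendsto x).comp hx

/-! ### Singular sources and the contraction estimate. -/

theorem RLAdmissible.rpow_neg_mul {σ : ℝ} (hσ : σ < 1) {φ : ℝ → ℝ} (hφ : Continuous φ) :
    RLAdmissible fun s => s ^ (-σ) * φ s := by
  refine ⟨fun t _ => ?_, fun t ht => ?_⟩
  · exact (intervalIntegral.intervalIntegrable_rpow' (by linarith)).mul_continuousOn
      hφ.continuousOn
  · exact (Real.continuousAt_rpow_const _ _ (Or.inl ht.ne')).mul hφ.continuousAt

theorem RLAdmissible.rpow_neg {σ : ℝ} (hσ : σ < 1) : RLAdmissible fun s => s ^ (-σ) := by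
  simpa using RLAdmissible.rpow_neg_mul hσ (continuous_const (y := (1 : ℝ)))

theorem greenOp_nonneg {α : ℝ} (hα : 3 ≤ α) {h : ℝ → ℝ} (hh : ∀ s ∈ Ioc (0 : ℝ) 1, 0 ≤ h s) {t : ℝ}
    (ht : t ∈ Icc (0 : ℝ) 1) : 0 ≤ greenOp α h t := by
  rw [greenOp, intervalIntegral.integral_of_le zero_le_one]
  exact setIntegral_nonneg measurableSet_Ioc fun s hs =>
    mul_nonneg (green_nonneg hα ht ⟨hs.1.le, hs.2⟩) (hh s hs)

theorem greenOp_pos {α : ℝ} (hα : 3 ≤ α) {h : ℝ → ℝ} (hh : RLAdmissible h)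
    (hpos : ∀ s ∈ Ioo (0 : ℝ) 1, 0 < h s) {t : ℝ} (ht : t ∈ Ioo (0 : ℝ) 1) :
    0 < greenOp α h t := by
  have hi := intervalIntegrable_green_mul (by linarith : 2 ≤ α) hh t
  have hsub : ∀ a ∈ Icc (0 : ℝ) 1, ∀ b ∈ Icc (0 : ℝ) 1,
      IntervalIntegrable (fun s => green α t s * h s) volume a b := fun a ha b hb =>
    hi.mono_set (by rw [uIcc_of_le zero_le_one]; exact ordConnected_Icc.uIcc_subset ha hb)
  have ht' := Ioo_subset_Icc_self ht
  have h1 := hsub t ht' 1 (by simp)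
  rw [greenOp, ← intervalIntegral.integral_add_adjacent_intervals (hsub 0 (by simp) t ht') h1]
  -- Strict positivity comes from `s > t`, where every term of `G` has a visible sign.
  refine add_pos_of_nonneg_of_pos ?_ ?_
  · rw [intervalIntegral.integral_of_le ht.1.le]
    exact setIntegral_nonneg measurableSet_Ioc fun s hs =>
      mul_nonneg (green_nonneg hα ht' ⟨hs.1.le, hs.2.trans ht.2.le⟩)
        (hpos s ⟨hs.1, hs.2.trans_lt ht.2⟩).le
  · exact intervalIntegral.intervalIntegral_pos_of_pos_on h1 (fun s hs =>
      mul_pos (green_pos (by linarith) ht.1 hs.1 hs.2) (hpos s ⟨ht.1.trans hs.1, hs.2⟩)) ht.2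

theorem abs_greenOp_sub_le {α : ℝ} (hα : 3 ≤ α) {h k m : ℝ → ℝ} (hh : RLAdmissible h)
    (hk : RLAdmissible k) (hm : RLAdmissible m) {C : ℝ}
    (hC : ∀ s ∈ Ioc (0 : ℝ) 1, |h s - k s| ≤ C * m s) {t : ℝ} (ht : t ∈ Icc (0 : ℝ) 1) :
    |greenOp α h t - greenOp α k t| ≤ C * greenOp α m t := by
  have hα2 : 2 ≤ α := by linarith
  rw [greenOp, greenOp, greenOp, ← intervalIntegral.integral_sub
    (intervalIntegrable_green_mul hα2 hh t) (intervalIntegrable_green_mul hα2 hk t),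
    ← intervalIntegral.integral_const_mul, ← Real.norm_eq_abs]
  refine intervalIntegral.norm_integral_le_of_norm_le zero_le_one
    (Eventually.of_forall fun s hs => ?_) ((intervalIntegrable_green_mul hα2 hm t).const_mul C)
  have hG := green_nonneg hα ht ⟨hs.1.le, hs.2⟩
  rw [← mul_sub, norm_mul, Real.norm_of_nonneg hG, Real.norm_eq_abs, mul_left_comm]
  exact mul_le_mul_of_nonneg_left (hC s hs) hG

/-- The expression is the square of the increasing function `√x/(1+τ√x)`. Monotonicity lets the
pointwise hypothesis on `f` be bounded by the uniform distance. -/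
theorem div_one_add_mul_sqrt_sq_mono {τ x y : ℝ} (hτ : 0 ≤ τ) (hx : 0 ≤ x) (hxy : x ≤ y) :
    x / (1 + τ * √x) ^ 2 ≤ y / (1 + τ * √y) ^ 2 := by
  have h1 : ∀ z : ℝ, 0 ≤ z → z / (1 + τ * √z) ^ 2 = (√z / (1 + τ * √z)) ^ 2 := fun z hz => by
    rw [div_pow, Real.sq_sqrt hz]
  rw [h1 x hx, h1 y (hx.trans hxy)]
  have h2 := Real.sqrt_le_sqrt hxy
  have h3 : √x / (1 + τ * √x) ≤ √y / (1 + τ * √y) := by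
    rw [div_le_div_iff₀ (by positivity) (by positivity)]
    nlinarith
  gcongr

theorem eq_of_dist_le_div {X : Type*} [MetricSpace X] {τ : ℝ} (hτ : 0 < τ) {x y : X}
    (h : dist x y ≤ dist x y / (1 + τ * √(dist x y)) ^ 2) : x = y := by
  by_contra hne
  have hd : 0 < dist x y := dist_pos.2 hne
  have hs : 0 < τ * √(dist x y) := mul_pos hτ (Real.sqrt_pos.2 hd)
  have : dist x y / (1 + τ * √(dist x y)) ^ 2 < dist x y := div_lt_self hd (by nlinarith)
  linarith

/-- Constant extension to the line of a non-negative function on the unit interval. -/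
def nnExtend (w : C(Icc (0 : ℝ) 1, NNReal)) (s : ℝ) : ℝ := w (projIcc 0 1 zero_le_one s)

/-- The function `s ^ (-σ) * g(s, w(s))`, with `s ↦ g(s, w(s))` extended constantly. -/
def weightedSource (σ : ℝ) (g : ℝ → ℝ → ℝ) (w : C(Icc (0 : ℝ) 1, NNReal)) (s : ℝ) : ℝ :=
  s ^ (-σ) * g (projIcc (0 : ℝ) 1 zero_le_one s) (nnExtend w s)

theorem nnExtend_of_mem (w : C(Icc (0 : ℝ) 1, NNReal)) {s : ℝ} (hs : s ∈ Icc (0 : ℝ) 1) :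
    nnExtend w s = w ⟨s, hs⟩ := by
  rw [nnExtend, projIcc_of_mem _ hs]

theorem nnExtend_nonneg (w : C(Icc (0 : ℝ) 1, NNReal)) (s : ℝ) : 0 ≤ nnExtend w s :=
  NNReal.coe_nonneg _

theorem abs_nnExtend_sub_le (w z : C(Icc (0 : ℝ) 1, NNReal)) (s : ℝ) :
    |nnExtend w s - nnExtend z s| ≤ dist w z := by
  rw [nnExtend, nnExtend, ← NNReal.dist_eq]
  exact ContinuousMap.dist_apply_le_dist _

theorem admissible_weightedSource {σ : ℝ} (hσ : σ < 1) {g : ℝ → ℝ → ℝ}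
    (hg : ContinuousOn (fun p : ℝ × ℝ => g p.1 p.2) (Icc 0 1 ×ˢ Ici 0))
    (w : C(Icc (0 : ℝ) 1, NNReal)) : RLAdmissible (weightedSource σ g w) := by
  refine RLAdmissible.rpow_neg_mul hσ ?_
  have hw : Continuous (nnExtend w) :=
    NNReal.continuous_coe.comp (w.continuous.comp continuous_projIcc)
  have hp : Continuous fun s : ℝ => ((projIcc (0 : ℝ) 1 zero_le_one s : ℝ), nnExtend w s) :=
    (continuous_subtype_val.comp continuous_projIcc).prodMk hw
  exact hg.comp_continuous hp fun s =>
    ⟨(projIcc (0 : ℝ) 1 zero_le_one s).2, nnExtend_nonneg w s⟩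

theorem weightedSource_eq {σ : ℝ} {f g : ℝ → ℝ → ℝ}
    (hfg : ∀ t ∈ Ioc (0 : ℝ) 1, ∀ y ∈ Ici (0 : ℝ), g t y = t ^ σ * f t y)
    (w : C(Icc (0 : ℝ) 1, NNReal)) {s : ℝ} (hs : s ∈ Ioc (0 : ℝ) 1) :
    weightedSource σ g w s = f s (nnExtend w s) := by
  rw [weightedSource, projIcc_of_mem _ (Ioc_subset_Icc_self hs),
    hfg s hs _ (nnExtend_nonneg w s), ← mul_assoc, ← Real.rpow_add hs.1, neg_add_cancel,
    Real.rpow_zero, one_mul]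

theorem IsNonnegSolution.isClampedSolution {α : ℝ} {f : ℝ → ℝ → ℝ} {v h : ℝ → ℝ}
    (hv : IsNonnegSolution α f v) (hh : ∀ t ∈ Ioo (0 : ℝ) 1, h t = f t (v t)) :
    IsClampedSolution α h v where
  continuousOn := hv.continuousOn
  differentiable := hv.differentiable
  equation t ht := (hv.equation t ht).trans (hh t ht).symm
  left_value := hv.left_value
  right_value := hv.right_value
  left_deriv := hv.left_deriv
  right_deriv := hv.right_deriv

theorem IsClampedSolution.isNonnegSolution {α : ℝ} {f : ℝ → ℝ → ℝ} {v h : ℝ → ℝ}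
    (hv : IsClampedSolution α h v) (hh : ∀ t ∈ Ioo (0 : ℝ) 1, h t = f t (v t))
    (hnn : ∀ t ∈ Icc (0 : ℝ) 1, 0 ≤ v t) : IsNonnegSolution α f v where
  continuousOn := hv.continuousOn
  nonneg := hnn
  differentiable := hv.differentiable
  equation t ht := (hv.equation t ht).trans (hh t ht)
  left_value := hv.left_value
  right_value := hv.right_value
  left_deriv := hv.left_deriv
  right_deriv := hv.right_deriv

theorem dist_greenOp_weightedSource_le {σ α N lam τ : ℝ} (hσ : σ < 1) (hα : 3 ≤ α)
    (hN : ∀ t ∈ Icc (0 : ℝ) 1, greenOp α (fun s => s ^ (-σ)) t ≤ N) (hN0 : 0 < N)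
    (hlam0 : 0 < lam) (hlam : lam ≤ 1 / N) (hτ : 0 < τ) {f g : ℝ → ℝ → ℝ}
    (hg : ContinuousOn (fun p : ℝ × ℝ => g p.1 p.2) (Icc 0 1 ×ˢ Ici 0))
    (hfg : ∀ t ∈ Ioc (0 : ℝ) 1, ∀ y ∈ Ici (0 : ℝ), g t y = t ^ σ * f t y)
    (hf : ∀ t ∈ Ioc (0 : ℝ) 1, ∀ x ∈ Ici (0 : ℝ), ∀ y ∈ Ici (0 : ℝ),
      t ^ σ * |f t x - f t y| ≤ lam * |x - y| / (1 + τ * √|x - y|) ^ 2)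
    (w z : C(Icc (0 : ℝ) 1, NNReal)) {t : ℝ} (ht : t ∈ Icc (0 : ℝ) 1) :
    |greenOp α (weightedSource σ g w) t - greenOp α (weightedSource σ g z) t|
      ≤ dist w z / (1 + τ * √(dist w z)) ^ 2 := by
  set D := dist w z / (1 + τ * √(dist w z)) ^ 2 with hD
  have hD0 : 0 ≤ D := by positivity
  have hC : ∀ s ∈ Ioc (0 : ℝ) 1, |weightedSource σ g w s - weightedSource σ g z s|
      ≤ lam * D * s ^ (-σ) := by
    intro s hs
    rw [weightedSource_eq hfg w hs, weightedSource_eq hfg z hs]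
    have h1 := hf s hs _ (nnExtend_nonneg w s) _ (nnExtend_nonneg z s)
    rw [mul_div_assoc] at h1
    have h2 := div_one_add_mul_sqrt_sq_mono hτ.le (abs_nonneg _) (abs_nnExtend_sub_le w z s)
    have h3 := h1.trans (mul_le_mul_of_nonneg_left h2 hlam0.le)
    rw [Real.rpow_neg hs.1.le, ← div_eq_mul_inv, le_div_iff₀ (Real.rpow_pos_of_pos hs.1 _),
      mul_comm]
    exact h3
  refine (abs_greenOp_sub_le hα (admissible_weightedSource hσ hg w)
    (admissible_weightedSource hσ hg z) (RLAdmissible.rpow_neg hσ) hC ht).trans ?_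
  calc lam * D * greenOp α (fun s => s ^ (-σ)) t ≤ lam * D * N := by
        have := hN t ht
        gcongr
    _ = lam * N * D := by ring
    _ ≤ 1 * D := by
        gcongr
        exact (le_div_iff₀ hN0).1 hlam
    _ = D := one_mul D

end
-- Existence and uniqueness for the nonlinear problem.
theorem theorem6 (σ α : ℝ) (hσ0 : 0 < σ) (hσ1 : σ < 1) (hα3 : 3 < α) (hα4 : α ≤ 4) :
    ∃ N : ℝ,
      IsGreatest ((fun t : ℝ => ∫ s in (0 : ℝ)..1, green α t s * s ^ (-σ)) '' Icc 0 1) N ∧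
      0 < N ∧
      ∀ (f : ℝ → ℝ → ℝ) (lam τ : ℝ),
        -- `f : (0,1] × [0,∞) → [0,∞)` is continuous and singular at `t = 0`
        (∀ t ∈ Ioc (0 : ℝ) 1, ∀ y ∈ Ici (0 : ℝ), 0 ≤ f t y) →
        ContinuousOn (fun p : ℝ × ℝ => f p.1 p.2) (Ioc 0 1 ×ˢ Ici 0) →
        (∀ y ∈ Ici (0 : ℝ), Tendsto (fun t => f t y) (𝓝[>] 0) atTop) →
        -- `t ^ σ * f t y` is (extends to) a continuous function on `[0,1] × [0,∞)`
        (∃ g : ℝ → ℝ → ℝ,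
          ContinuousOn (fun p : ℝ × ℝ => g p.1 p.2) (Icc 0 1 ×ˢ Ici 0) ∧
          ∀ t ∈ Ioc (0 : ℝ) 1, ∀ y ∈ Ici (0 : ℝ), g t y = t ^ σ * f t y) →
        0 < lam → lam ≤ 1 / N → 0 < τ →
        (∀ t ∈ Ioc (0 : ℝ) 1, ∀ x ∈ Ici (0 : ℝ), ∀ y ∈ Ici (0 : ℝ),
          t ^ σ * |f t x - f t y| ≤ lam * |x - y| / (1 + τ * √|x - y|) ^ 2) →
        ∃ u : ℝ → ℝ, IsNonnegSolution α f u ∧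
          ∀ v : ℝ → ℝ, IsNonnegSolution α f v → EqOn v u (Icc 0 1) := by
  have hadm := RLAdmissible.rpow_neg hσ1
  obtain ⟨t₀, ht₀, hmax⟩ := isCompact_Icc.exists_isMaxOn (nonempty_Icc.2 zero_le_one)
    (continuousOn_greenOp (by linarith : 2 ≤ α) hadm)
  have hN : ∀ t ∈ Icc (0 : ℝ) 1, greenOp α (fun s => s ^ (-σ)) t
      ≤ greenOp α (fun s => s ^ (-σ)) t₀ := fun t ht => hmax ht
  have hN0 : 0 < greenOp α (fun s => s ^ (-σ)) t₀ :=
    (greenOp_pos hα3.le hadm (fun s hs => Real.rpow_pos_of_pos hs.1 _)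
      (t := 1 / 2) (by norm_num)).trans_le (hN _ (by norm_num))
  refine ⟨greenOp α (fun s => s ^ (-σ)) t₀, ⟨⟨t₀, ht₀, rfl⟩, ?_⟩, hN0, ?_⟩
  · rintro _ ⟨t, ht, rfl⟩
    exact hN t ht
  intro f lam τ hf0 _ _ ⟨g, hg, hfg⟩ hlam0 hlam hτ hf
  have hsrc := admissible_weightedSource hσ1 hg
  have hnn : ∀ w, ∀ t ∈ Icc (0 : ℝ) 1, 0 ≤ greenOp α (weightedSource σ g w) t := fun w t ht =>
    greenOp_nonneg hα3.le (fun s hs => by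
      rw [weightedSource_eq hfg w hs]
      exact hf0 s hs _ (nnExtend_nonneg w s)) ht
  -- Values in `NNReal` build non-negativity into a complete space, so `f` is evaluated only where
  -- the hypotheses hold.
  let T : C(Icc (0 : ℝ) 1, NNReal) → C(Icc (0 : ℝ) 1, NNReal) := fun w =>
    ⟨fun t => ⟨greenOp α (weightedSource σ g w) t, hnn w t t.2⟩,
      (continuousOn_iff_continuous_domRestrict.1
        (continuousOn_greenOp (by linarith) (hsrc w))).subtype_mk _⟩
  have hT : ∀ w z, dist (T w) (T z) ≤ dist w z / (1 + τ * √(dist w z)) ^ 2 := fun w z =>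
    (ContinuousMap.dist_le (by positivity)).2 fun t =>
      dist_greenOp_weightedSource_le hσ1 hα3.le hN hN0 hlam0 hlam hτ hg hfg hf w z t.2
  obtain ⟨w, hw⟩ := exists_fixedPoint_of_dist_le hτ hT
  have hwE : ∀ t ∈ Icc (0 : ℝ) 1, greenOp α (weightedSource σ g w) t = nnExtend w t := by
    intro t ht
    rw [nnExtend_of_mem w ht]
    exact congrArg (fun z : C(Icc (0 : ℝ) 1, NNReal) => (z ⟨t, ht⟩ : ℝ)) hw
  refine ⟨greenOp α (weightedSource σ g w), ?_, fun v hv => ?_⟩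
  · refine (isClampedSolution_greenOp hα3 (hsrc w)).isNonnegSolution (fun t ht => ?_) (hnn w)
    rw [hwE t (Ioo_subset_Icc_self ht), weightedSource_eq hfg w (Ioo_subset_Ioc_self ht)]
  -- Any solution, restricted to `[0,1]`, is a fixed point of `T` by uniqueness in the linear
  -- problem.
  · let z : C(Icc (0 : ℝ) 1, NNReal) := ⟨fun t => ⟨v t, hv.nonneg t t.2⟩,
      (continuousOn_iff_continuous_domRestrict.1 hv.continuousOn).subtype_mk _⟩
    have hz : EqOn v (greenOp α (weightedSource σ g z)) (Icc 0 1) := by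
      refine (hv.isClampedSolution fun t ht => ?_).eqOn_greenOp hα3 hα4 (hsrc z)
      rw [weightedSource_eq hfg z (Ioo_subset_Ioc_self ht),
        nnExtend_of_mem z (Ioo_subset_Icc_self ht)]
      rfl
    have hTz : T z = z := ContinuousMap.ext fun t => NNReal.eq (hz t.2).symm
    have hzw : z = w := eq_of_dist_le_div hτ (by
      have := hT z w
      rwa [hTz, hw] at this)
    rw [← hzw]
    exact hz
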